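/- For $\alpha\in(0,1)$ and $n\in\mathbb{N}$ let $N_\alpha(n)$ be the maximum number of equiangular lines in $\mathbb{R}^n$ with angle $\arccos\alpha$, that is, the maximum size of a family of lines through the origin of $\mathbb{R}^n$ such that the (non-obtuse) angle between any two distinct lines of the family equals $\arccos\alpha$. The spectral radius of a finite simple graph is the largest eigenvalue of its adjacency matrix. For $\lambda>0$, the spectral radius order $k(\lambda)$ is the smallest number of vertices of a graph with spectral radius $\lambda$, and $k(\lambda)=\infty$ if $\lambda$ is not the spectral radius of any graph. Let $\alpha\in(0,1)$ be such that $\lambda:=\frac{1-\alpha}{2\alpha}\le\lambda^*:=\sqrt{2+\sqrt5}$. Then the maximum $N_\alpha(n)$ exists for every $n$, and the following holds, where the constants implied in $O(1)$ may depend on $\alpha$ but not on $n$. If $k(\lambda)<\infty$, then $k(\lambda)\ge 2$ and $$N_\alpha(n)=\frac{k(\lambda)}{k(\lambda)-1}\cdot n+O(1).$$ If $k(\lambda)=\infty$, then $N_\alpha(n)=n+O(1)$. In particular, $N_{1/3}(n)=2n+O(1)$, $N_{1/5}(n)=\frac32 n+O(1)$ and $N_{1/(1+2\sqrt2)}(n)=\frac32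 n+O(1)$. -/

import Mathlib

noncomputable section

namespace Equiangular

/-- `S` is a family of lines through the origin of `ℝⁿ` (one-dimensional linear subspaces) such
that the angle between any two distinct members is `arccos α`. The angle between two lines is the
smaller of the two angles that direction vectors `u`, `v` and `u`, `-v` enclose. -/
def IsEquiangular (α : ℝ) {n : ℕ} (S : Set (Submodule ℝ (EuclideanSpace ℝ (Fin n)))) : Prop :=
  (∀ l ∈ S, Module.finrank ℝ l = 1) ∧
  ∀ l₁ ∈ S, ∀ l₂ ∈ S, l₁ ≠ l₂ → ∀ u ∈ l₁, ∀ v ∈ l₂, u ≠ 0 → v ≠ 0 →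
    min (InnerProductGeometry.angle u v) (InnerProductGeometry.angle u (-v)) = Real.arccos α

/-- The cardinalities of finite families of equiangular lines in `ℝⁿ` with angle `arccos α`. -/
def equiangularSizes (α : ℝ) (n : ℕ) : Set ℕ :=
  {m | ∃ S : Finset (Submodule ℝ (EuclideanSpace ℝ (Fin n))),
    IsEquiangular α (S : Set (Submodule ℝ (EuclideanSpace ℝ (Fin n)))) ∧ S.card = m}

/-- The maximum number `N_α(n)` of equiangular lines in `ℝⁿ` with angle `arccos α`. -/
def maxEquiangular (α : ℝ) (n : ℕ) : ℕ := sSup (equiangularSizes α n)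

open Classical in
/-- `μ` is the spectral radius of the finite graph `G`: the largest eigenvalue of its
adjacency matrix. -/
def HasSpectralRadius {V : Type*} [Fintype V] (G : SimpleGraph V) (μ : ℝ) : Prop :=
  IsGreatest {x : ℝ | Module.End.HasEigenvalue (Matrix.toLin' (G.adjMatrix ℝ)) x} μ

/-- The spectral radius order `k(μ)`: the smallest order of a graph with spectral radius `μ`,
and `⊤` if there is no such graph. -/
def spectralRadiusOrder (μ : ℝ) : ℕ∞ :=
  sInf {k : ℕ∞ | ∃ m : ℕ, k = (m : ℕ∞) ∧ ∃ G : SimpleGraph (Fin m), HasSpectralRadius G μ}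

/-- `N_α(n) = c * n + O(1)`, with an implied constant that may depend on `α` and `c`
but not on `n`. -/
def MaxEquiangularAsymp (α c : ℝ) : Prop :=
  ∃ C : ℝ, ∀ n : ℕ, |(maxEquiangular α n : ℝ) - c * (n : ℝ)| ≤ C

end Equiangular

end

/-! Choose unit vectors `v i` on the lines and join `i` to `j` when their inner product is `-α`. The
Gram matrix is `(1-α) I + α J - 2α A`, so on vectors of sum zero the form of `A` is at most `λ`
(`secondLe_negGraph`), and a linear relation of the `v i` with coefficients of sum zero is a
`λ`-eigenvector of `A`. Hence `N ≤ n + 1 + |W|` for any vertex set `W` on which a nonzero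
`λ`-eigenvector cannot vanish (`card_le_of_determines`).

A small `W` is found as follows. After sign changes all degrees are bounded (`exists_switching`). At
most one component has spectral radius above `λ`. In the others a `λ`-eigenvector is fixed by one
value, and a component carrying one has spectral radius exactly `λ`, hence at least `k(λ)` vertices;
this costs `N / k(λ)` values. The exceptional component costs `O(1)`: for `λ < λ*` a long path with
a pendant vertex at its middle (a broom) has spectral radius above `λ`. If the graph contains one,
the broom with its neighbours serves as `W`; if not, far from a root the component consists of
boundedly many bare paths with short ends, along which the eigenvector equation propagates zeros
(`exists_determining_of_not_hasBroom`). For `λ = λ*` there are no eigenvectors, as `λ*` has a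
non-real conjugate (`determines_empty`).

For the lower bound, a graph on `k` vertices with spectral radius `λ` yields vectors in dimension `k
- 1`; orthogonal copies with one added common coordinate give `t k` lines in dimension `t (k-1) + 1`
(`mul_mem_of_hasSpectralRadius`). -/

namespace Equiangular

open Finset

/-! ### Ramsey's theorem -/

/-- Off-diagonal Ramsey theorem for finite sets of vertices. -/
theorem exists_ramsey (q M : ℕ) : ∃ R : ℕ, ∀ {V : Type} (G : SimpleGraph V) (S : Finset V),
    R ≤ S.card → (∃ T ⊆ S, T.card = q ∧ ∀ i ∈ T, ∀ j ∈ T, i ≠ j → G.Adj i j) ∨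
      (∃ T ⊆ S, T.card = M ∧ ∀ i ∈ T, ∀ j ∈ T, i ≠ j → ¬ G.Adj i j) := by
  classical
  induction q generalizing M with
  | zero => exact ⟨0, fun G S _ => Or.inl ⟨∅, by simp⟩⟩
  | succ q ihq =>
    induction M with
    | zero => exact ⟨0, fun G S _ => Or.inr ⟨∅, by simp⟩⟩
    | succ M ihM =>
      obtain ⟨R₁, h₁⟩ := ihq (M + 1)
      obtain ⟨R₂, h₂⟩ := ihM
      refine ⟨R₁ + R₂ + 1, fun {V} G S hS => ?_⟩
      obtain ⟨v, hv⟩ : S.Nonempty := by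
        rw [← Finset.card_pos]; omega
      have hcard : ((S.erase v).filter (G.Adj v)).card
          + ((S.erase v).filter (fun w => ¬ G.Adj v w)).card = S.card - 1 := by
        rw [Finset.card_filter_add_card_filter_not, Finset.card_erase_of_mem hv]
      by_cases hc : R₁ ≤ ((S.erase v).filter (G.Adj v)).card
      · rcases h₁ G _ hc with ⟨T, hT, hTc, hTa⟩ | ⟨T, hT, hTc, hTa⟩
        · left
          have hvT : v ∉ T := fun h => by simpa using hT h
          refine ⟨insert v T, ?_, by rw [Finset.card_insert_of_notMem hvT, hTc], ?_⟩
          · intro x hx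
            rcases Finset.mem_insert.1 hx with rfl | hx
            · exact hv
            · exact Finset.mem_of_mem_erase (Finset.mem_filter.1 (hT hx)).1
          · intro i hi j hj hij
            rcases Finset.mem_insert.1 hi with h | hi' <;>
              rcases Finset.mem_insert.1 hj with h' | hj'
            · exact absurd (h.trans h'.symm) hij
            · subst h; exact (Finset.mem_filter.1 (hT hj')).2
            · subst h'; exact (Finset.mem_filter.1 (hT hi')).2.symm
            · exact hTa i hi' j hj' hij
        · right
          exact ⟨T, fun x hx => Finset.mem_of_mem_erase (Finset.mem_filter.1 (hT hx)).1, hTc, hTa⟩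
      · have hc' : R₂ ≤ ((S.erase v).filter (fun w => ¬ G.Adj v w)).card := by omega
        rcases h₂ G _ hc' with ⟨T, hT, hTc, hTa⟩ | ⟨T, hT, hTc, hTa⟩
        · left
          exact ⟨T, fun x hx => Finset.mem_of_mem_erase (Finset.mem_filter.1 (hT hx)).1, hTc, hTa⟩
        · right
          have hvT : v ∉ T := fun h => by simpa using hT h
          refine ⟨insert v T, ?_, by rw [Finset.card_insert_of_notMem hvT, hTc], ?_⟩
          · intro x hx
            rcases Finset.mem_insert.1 hx with rfl | hx
            · exact hv
            · exact Finset.mem_of_mem_erase (Finset.mem_filter.1 (hT hx)).1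
          · intro i hi j hj hij
            rcases Finset.mem_insert.1 hi with h | hi' <;>
              rcases Finset.mem_insert.1 hj with h' | hj'
            · exact absurd (h.trans h'.symm) hij
            · subst h; exact (Finset.mem_filter.1 (hT hj')).2
            · subst h'; exact fun h => (Finset.mem_filter.1 (hT hi')).2 h.symm
            · exact hTa i hi' j hj' hij

/-! ### Switching signs to bound the degrees -/

section Switching

variable {V E : Type} [NormedAddCommGroup E] [InnerProductSpace ℝ E]

/-- The squared length of a sum of unit vectors with constant pairwise inner products. -/
theorem inner_sum_self_of_const {v : V → E} {β : ℝ} {T : Finset V} (h1 : ∀ i ∈ T, ‖v i‖ = 1)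
    (h2 : ∀ i ∈ T, ∀ j ∈ T, i ≠ j → inner ℝ (v i) (v j) = β) :
    inner ℝ (∑ i ∈ T, v i) (∑ i ∈ T, v i) = T.card * (1 - β) + (T.card : ℝ) ^ 2 * β := by
  classical
  rw [sum_inner]
  have : ∀ i ∈ T, inner ℝ (v i) (∑ j ∈ T, v j) = (1 - β) + T.card * β := by
    intro i hi
    rw [inner_sum, ← Finset.add_sum_erase T _ hi, real_inner_self_eq_norm_sq, h1 i hi,
      Finset.sum_congr rfl (fun j hj => h2 i hi j (Finset.mem_of_mem_erase hj)
        (Finset.ne_of_mem_erase hj).symm), Finset.sum_const, Finset.card_erase_of_mem hi,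
      nsmul_eq_mul, Nat.cast_sub (Finset.card_pos.2 ⟨i, hi⟩)]
    push_cast; ring
  rw [Finset.sum_congr rfl this, Finset.sum_const, nsmul_eq_mul]; ring

/-- A set of unit vectors with pairwise inner products `-α` is small. -/
theorem card_le_of_inner_eq_neg {v : V → E} {α : ℝ} {T : Finset V} (h1 : ∀ i ∈ T, ‖v i‖ = 1)
    (h2 : ∀ i ∈ T, ∀ j ∈ T, i ≠ j → inner ℝ (v i) (v j) = -α) :
    (T.card : ℝ) * (T.card * α) ≤ T.card * (1 + α) := by
  have := inner_sum_self_of_const h1 h2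
  have h3 : 0 ≤ inner ℝ (∑ i ∈ T, v i) (∑ i ∈ T, v i) := real_inner_self_nonneg
  nlinarith

/-- A unit vector cannot have many inner products at least `α` and many at most `-α` with a
family of unit vectors whose pairwise inner products are `α`. -/
theorem not_both_large {v : V → E} {α : ℝ} (hα : 0 < α) {X : Finset V}
    (h1 : ∀ i ∈ X, ‖v i‖ = 1) (h2 : ∀ i ∈ X, ∀ j ∈ X, i ≠ j → inner ℝ (v i) (v j) = α)
    {a : ℕ} (ha : 1 ≤ a * α ^ 2) {u : E} (hu : ‖u‖ = 1) {P N : Finset V} (hP : P ⊆ X) (hN : N ⊆ X)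
    (hPu : ∀ i ∈ P, α ≤ inner ℝ u (v i)) (hNu : ∀ i ∈ N, inner ℝ u (v i) ≤ -α)
    (haP : a ≤ P.card) (haN : a ≤ N.card) : False := by
  classical
  -- With `p`, `q` the sums over `a` vectors of each kind, `⟨u, p - q⟩ ≥ 2aα` while `‖p - q‖² =
  -- 2a(1-α)`; Cauchy-Schwarz then contradicts `a α² ≥ 1`.
  obtain ⟨P', hP', hPc⟩ := Finset.exists_subset_card_eq haP
  obtain ⟨N', hN', hNc⟩ := Finset.exists_subset_card_eq haN
  have e1 := inner_sum_self_of_const (T := P') (fun i hi => h1 i (hP (hP' hi)))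
    (fun i hi j hj => h2 i (hP (hP' hi)) j (hP (hP' hj)))
  have e2 := inner_sum_self_of_const (T := N') (fun i hi => h1 i (hN (hN' hi)))
    (fun i hi j hj => h2 i (hN (hN' hi)) j (hN (hN' hj)))
  have e3 : inner ℝ (∑ i ∈ P', v i) (∑ i ∈ N', v i) = (a : ℝ) ^ 2 * α := by
    rw [sum_inner, Finset.sum_congr rfl (g := fun _ => (a : ℝ) * α), Finset.sum_const, hPc]
    · rw [nsmul_eq_mul]; ring
    · intro i hi
      rw [inner_sum, Finset.sum_congr rfl (g := fun _ => α), Finset.sum_const, hNc, nsmul_eq_mul]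
      intro j hj
      refine h2 i (hP (hP' hi)) j (hN (hN' hj)) ?_
      rintro rfl
      have := hPu i (hP' hi)
      have := hNu i (hN' hj)
      linarith
  rw [hPc] at e1
  rw [hNc] at e2
  have f1 : (a : ℝ) * α ≤ inner ℝ u (∑ i ∈ P', v i) := by
    rw [inner_sum, ← hPc, ← nsmul_eq_mul]
    exact Finset.card_nsmul_le_sum _ _ _ (fun i hi => hPu i (hP' hi))
  have f2 : inner ℝ u (∑ i ∈ N', v i) ≤ (a : ℝ) * (-α) := by
    rw [inner_sum, ← hNc, ← nsmul_eq_mul]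
    exact Finset.sum_le_card_nsmul _ _ _ (fun i hi => hNu i (hN' hi))
  set p := ∑ i ∈ P', v i
  set q := ∑ i ∈ N', v i
  have cs := real_inner_mul_inner_self_le u (p - q)
  rw [real_inner_self_eq_norm_sq u, hu, inner_sub_right, inner_sub_left, inner_sub_right,
    inner_sub_right, e1, e2, e3, real_inner_comm p q, e3] at cs
  have g : 2 * (a * α) ≤ inner ℝ u p - inner ℝ u q := by linarith
  have hapos : (0 : ℝ) < a := by
    rcases Nat.eq_zero_or_pos a with h | h
    · subst h; norm_num at ha
    · exact_mod_cast h
  have g2 : (2 * (a * α)) * (2 * (a * α)) ≤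
      (inner ℝ u p - inner ℝ u q) * (inner ℝ u p - inner ℝ u q) :=
    mul_self_le_mul_self (by positivity) g
  have : (4 : ℝ) * a * 1 ≤ 4 * a * (a * α ^ 2) := mul_le_mul_of_nonneg_left ha (by positivity)
  nlinarith

/-- If `u` is positively correlated with most of `X` and negatively with all of `Y`, and the two
cliques `X` and `Y` are positively correlated, then they are small. -/
theorem not_opposite_cliques {v w : V → E} {α : ℝ} (hα : 0 < α) (hα1 : α < 1) {X Y : Finset V}
    {L a : ℕ} (hX : X.card = L) (hY : Y.card = L)
    (h1 : ∀ i ∈ X, ‖v i‖ = 1) (h2 : ∀ i ∈ X, ∀ j ∈ X, i ≠ j → inner ℝ (v i) (v j) = α)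
    (k1 : ∀ i ∈ Y, ‖w i‖ = 1) (k2 : ∀ i ∈ Y, ∀ j ∈ Y, i ≠ j → inner ℝ (w i) (w j) = α)
    (hL : 2 * a ≤ L) (hL2 : 2 + 4 * a < L * α ^ 2)
    (hw : ∀ i ∈ Y, α * (L - 2 * a) ≤ inner ℝ (w i) (∑ j ∈ X, v j)) {u : E} (hu : ‖u‖ = 1)
    (huX : α * (L - 2 * a) ≤ inner ℝ u (∑ j ∈ X, v j))
    (huY : ∀ i ∈ Y, inner ℝ u (w i) = -α) : False := by
  have e1 := inner_sum_self_of_const h1 h2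
  have e2 := inner_sum_self_of_const k1 k2
  have e3 : (L : ℝ) * (α * (L - 2 * a)) ≤ inner ℝ (∑ i ∈ Y, w i) (∑ i ∈ X, v i) := by
    rw [sum_inner, ← nsmul_eq_mul]
    simpa only [hY] using Finset.card_nsmul_le_sum _ _ _ hw
  have e4 : inner ℝ u (∑ i ∈ Y, w i) = L * (-α) := by
    rw [inner_sum, Finset.sum_congr rfl huY, Finset.sum_const, hY, nsmul_eq_mul]
  rw [hX] at e1
  rw [hY] at e2
  set p := ∑ i ∈ X, v i
  set q := ∑ i ∈ Y, w i
  -- The terms `L²α` nearly cancel: `‖p - q‖² ≤ L(2 + 4a)`, whereas `⟨u, p - q⟩ ≥ αL`.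
  have cs := real_inner_mul_inner_self_le u (p - q)
  rw [real_inner_self_eq_norm_sq u, hu, inner_sub_right, inner_sub_left, inner_sub_right,
    inner_sub_right, e1, e2, real_inner_comm q p, e4] at cs
  have hL' : (2 : ℝ) * a ≤ L := by exact_mod_cast hL
  have ha0 : (0 : ℝ) ≤ a := by positivity
  have hLpos : (0 : ℝ) < L := by
    by_contra h
    have : (L : ℝ) = 0 := le_antisymm (not_lt.1 h) (by positivity)
    rw [this] at hL2; linarith
  have g : α * L ≤ inner ℝ u p - L * (-α) := by nlinarith
  have g2 : (α * L) * (α * L) ≤ (inner ℝ u p - L * (-α)) * (inner ℝ u p - L * (-α)) :=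
    mul_self_le_mul_self (by positivity) g
  have g3 : (2 + 4 * a) * L < (L * α ^ 2) * L := by gcongr
  have g4 : α * (a * L) ≤ a * L := by
    have : 0 ≤ a * (L : ℝ) := by positivity
    nlinarith
  nlinarith

/-- Equiangular lines can be represented by unit vectors such that each of them has only boundedly
many negative inner products with the others. -/
theorem exists_switching {α : ℝ} (hα : 0 < α) (hα1 : α < 1) : ∃ Δ : ℕ,
    ∀ {V E : Type} [NormedAddCommGroup E] [InnerProductSpace ℝ E] [Fintype V] (v : V → E),
      (∀ i, ‖v i‖ = 1) → (∀ i j, i ≠ j → |inner ℝ (v i) (v j)| = α) →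
      ∃ w : V → E, (∀ i, w i = v i ∨ w i = -v i) ∧
        ∀ i, ∀ S : Finset V, (∀ j ∈ S, j ≠ i ∧ inner ℝ (w i) (w j) = -α) → S.card ≤ Δ := by
  classical
  -- `a` serves `not_both_large`, `q` is too large for vectors with pairwise products `-α`, and `L`
  -- serves `not_opposite_cliques`. The degree bound is the Ramsey number of `q` and `L`.
  obtain ⟨a, ha⟩ := exists_nat_ge (1 / α ^ 2)
  have ha : 1 ≤ a * α ^ 2 := by
    rwa [div_le_iff₀ (by positivity)] at ha
  obtain ⟨q, hq⟩ := exists_nat_gt ((1 + α) / α)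
  have hq : 1 + α < q * α := by rwa [div_lt_iff₀ hα] at hq
  obtain ⟨L₀, hL₀⟩ := exists_nat_gt ((2 + 4 * a) / α ^ 2)
  have hL₀ : 2 + 4 * a < L₀ * α ^ 2 := by rwa [div_lt_iff₀ (by positivity)] at hL₀
  set L := L₀ + 2 * a with hLdef
  have hL : 2 * a ≤ L := by omega
  have hL2 : 2 + 4 * a < (L : ℝ) * α ^ 2 := by
    have : (L₀ : ℝ) * α ^ 2 ≤ L * α ^ 2 := by gcongr; omega
    linarith
  obtain ⟨R, hR⟩ := exists_ramsey q L
  refine ⟨R, fun {V E} _ _ _ v hv1 hv2 => ?_⟩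
  have clique : ∀ (w : V → E), (∀ i, ‖w i‖ = 1) → (∀ i j, i ≠ j → |inner ℝ (w i) (w j)| = α) →
      ∀ S : Finset V, R ≤ S.card → ∃ T ⊆ S, T.card = L ∧
        ∀ i ∈ T, ∀ j ∈ T, i ≠ j → inner ℝ (w i) (w j) = α := by
    intro w hw1 hw2 S hS
    rcases hR (SimpleGraph.mk (fun i j => i ≠ j ∧ inner ℝ (w i) (w j) = -α)
      ⟨fun i j h => ⟨h.1.symm, by rw [real_inner_comm]; exact h.2⟩⟩ ⟨fun i h => h.1 rfl⟩) S hS with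
      ⟨T, hT, hTc, hTa⟩ | ⟨T, hT, hTc, hTa⟩
    · have := card_le_of_inner_eq_neg (T := T) (fun i _ => hw1 i)
        (fun i hi j hj hij => (hTa i hi j hj hij).2)
      rw [hTc] at this
      have hq0 : (0 : ℝ) < q := by
        by_contra h
        have : (q : ℝ) = 0 := le_antisymm (not_lt.1 h) (by positivity)
        rw [this] at hq; linarith
      have := le_of_mul_le_mul_left this hq0
      linarith
    · refine ⟨T, hT, hTc, fun i hi j hj hij => ?_⟩
      have h3 := hTa i hi j hj hij
      rcases eq_or_eq_neg_of_abs_eq (hw2 i j hij) with h | h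
      · exact h
      · exact absurd ⟨hij, h⟩ h3
  by_cases hcard : R ≤ (Finset.univ : Finset V).card
  swap
  · exact ⟨v, fun i => Or.inl rfl, fun i S _ =>
      (Finset.card_le_card (Finset.subset_univ S)).trans (not_le.1 hcard).le⟩
  -- `X` is a reference clique: each vector gets the sign that makes it positive on all but at most
  -- `a` members of `X`.
  obtain ⟨X, -, hXc, hX⟩ := clique v hv1 hv2 _ hcard
  have inner_cases : ∀ i j, α ≤ inner ℝ (v i) (v j) ∨ inner ℝ (v i) (v j) = -α := by
    intro i j
    by_cases hij : i = j
    · subst hij; left; rw [real_inner_self_eq_norm_sq, hv1]; linarith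
    · rcases eq_or_eq_neg_of_abs_eq (hv2 i j hij) with h | h
      · exact Or.inl h.ge
      · exact Or.inr h
  have key : ∀ i, ∃ ε : E, (ε = v i ∨ ε = -v i) ∧
      α * (L - 2 * a) ≤ inner ℝ ε (∑ j ∈ X, v j) := by
    intro i
    have split : ∀ (ε : E), ∀ N ⊆ X, N.card ≤ a → (∀ j ∈ N, -α ≤ inner ℝ ε (v j)) →
        (∀ j ∈ X, j ∉ N → α ≤ inner ℝ ε (v j)) → α * (L - 2 * a) ≤ inner ℝ ε (∑ j ∈ X, v j) := by
      intro ε N hNX hNa hN1 hN2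
      have h1 := Finset.card_nsmul_le_sum N _ _ hN1
      have h2 := Finset.card_nsmul_le_sum (X \ N) (fun j => inner ℝ ε (v j)) α
        (fun j hj => hN2 j (Finset.mem_sdiff.1 hj).1 (Finset.mem_sdiff.1 hj).2)
      rw [inner_sum, ← Finset.sum_sdiff hNX]
      rw [nsmul_eq_mul] at h1 h2
      rw [Finset.card_sdiff_of_subset hNX, Nat.cast_sub (Finset.card_le_card hNX), hXc] at h2
      have : (N.card : ℝ) ≤ a := by exact_mod_cast hNa
      nlinarith
    set N := X.filter (fun j => inner ℝ (v i) (v j) = -α) with hN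
    have hnot := fun h h' => not_both_large hα (fun i _ => hv1 i) hX ha (hv1 i)
      (P := X \ N) (N := N) Finset.sdiff_subset (Finset.filter_subset _ _)
      (fun j hj => (inner_cases i j).resolve_right (fun h => by
        rw [Finset.mem_sdiff] at hj
        exact hj.2 (Finset.mem_filter.2 ⟨hj.1, h⟩)))
      (fun j hj => (Finset.mem_filter.1 hj).2.le) h h'
    by_cases hNa : N.card ≤ a
    · refine ⟨v i, Or.inl rfl, split _ N (Finset.filter_subset _ _) hNa
        (fun j hj => (Finset.mem_filter.1 hj).2.ge) (fun j hj hjN =>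
        (inner_cases i j).resolve_right (fun h => hjN (Finset.mem_filter.2 ⟨hj, h⟩)))⟩
    · have hP : (X \ N).card < a := by
        by_contra h
        exact hnot (not_lt.1 h) (not_le.1 hNa).le
      -- A flipped vector must lie outside `X`, since `-v i` has product `-1`, below `-α`, with `v
      -- i`.
      have hiX : i ∉ X := by
        intro hi
        have : N = ∅ := by
          refine Finset.filter_eq_empty_iff.2 fun {j} hj h => ?_
          have : α ≤ inner ℝ (v i) (v j) := by
            by_cases hij : i = j
            · subst hij; rw [real_inner_self_eq_norm_sq, hv1]; linarith
            · exact (hX i hi j hj hij).ge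
          linarith
        rw [this] at hNa
        simp at hNa
      refine ⟨-v i, Or.inr rfl, split _ (X \ N) Finset.sdiff_subset hP.le (fun j hj => ?_)
        (fun j hj hjP => ?_)⟩
      · rw [inner_neg_left, neg_le_neg_iff]
        have hij : i ≠ j := fun h => hiX (h ▸ (Finset.mem_sdiff.1 hj).1)
        exact (le_abs_self _).trans (hv2 i j hij).le
      · rw [inner_neg_left]
        have : j ∈ N := by
          by_contra h
          exact hjP (Finset.mem_sdiff.2 ⟨hj, h⟩)
        rw [(Finset.mem_filter.1 this).2, neg_neg]
  choose w hw hwX using key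
  have hw1 : ∀ i, ‖w i‖ = 1 := by
    intro i; rcases hw i with h | h <;> rw [h] <;> simp [hv1]
  have hw2 : ∀ i j, i ≠ j → |inner ℝ (w i) (w j)| = α := by
    intro i j hij
    rcases hw i with h | h <;> rcases hw j with h' | h' <;> rw [h, h'] <;> simp [hv2 i j hij]
  refine ⟨w, hw, fun i S hS => ?_⟩
  -- Too many negative neighbours of `w i` would contain a clique `Y` which, like `w i`, leans
  -- towards `X`.
  by_contra hcon
  obtain ⟨Y, hYS, hYc, hY⟩ := clique w hw1 hw2 S (not_le.1 hcon).le
  exact not_opposite_cliques hα hα1 hXc hYc (fun i _ => hv1 i) hX (fun i _ => hw1 i) hY hL hL2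
    (fun i _ => hwX i) (hw1 i) (hwX i) (fun j hj => (hS j (hYS hj)).2)

end Switching

/-! ### The quadratic form of the adjacency matrix -/

section AdjForm

open scoped Classical Matrix

variable {V : Type} [Fintype V] (G : SimpleGraph V)

/-- The real adjacency matrix. -/
noncomputable def adj : Matrix V V ℝ := G.adjMatrix ℝ

theorem adj_mulVec (x : V → ℝ) (i : V) :
    (adj G *ᵥ x) i = ∑ j ∈ univ.filter (G.Adj i), x j := by
  rw [adj, SimpleGraph.adjMatrix_mulVec_apply]
  congr 1
  ext j; simp

theorem adj_form_comm (x y : V → ℝ) : x ⬝ᵥ adj G *ᵥ y = y ⬝ᵥ adj G *ᵥ x := by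
  have h : (adj G)ᵀ = adj G := by simp [adj]
  rw [Matrix.dotProduct_mulVec, ← Matrix.mulVec_transpose, h, dotProduct_comm]

theorem adj_form_abs (x : V → ℝ) : x ⬝ᵥ adj G *ᵥ x ≤ (|x|) ⬝ᵥ adj G *ᵥ (|x|) := by
  simp only [dotProduct, adj_mulVec, Finset.mul_sum]
  refine Finset.sum_le_sum fun i _ => Finset.sum_le_sum fun j _ => ?_
  rw [Pi.abs_apply, Pi.abs_apply, ← abs_mul]
  exact le_abs_self _

theorem abs_dotProduct_abs (x : V → ℝ) : (|x|) ⬝ᵥ (|x|) = x ⬝ᵥ x := by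
  simp [dotProduct, abs_mul_abs_self]

/-- The quadratic form of the adjacency matrix is at most `lam` on vectors of sum zero. -/
def SecondLe (lam : ℝ) : Prop :=
  ∀ x : V → ℝ, ∑ i, x i = 0 → x ⬝ᵥ adj G *ᵥ x ≤ lam * (x ⬝ᵥ x)

/-- The `lam`-eigenvectors of `G` vanish as soon as they vanish on `W`. -/
def Determines (lam : ℝ) (W : Finset V) : Prop :=
  ∀ y : V → ℝ, adj G *ᵥ y = lam • y → (∀ w ∈ W, y w = 0) → y = 0

variable {G}

/-- As `g ≥ 0` is nonzero, some `f - c g` has sum zero. The cross terms vanish, so the form on it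
still exceeds `lam` times its squared length. -/
theorem SecondLe.false_of_two {lam : ℝ} (h : SecondLe G lam) {f g : V → ℝ}
    (hf : lam * (f ⬝ᵥ f) < f ⬝ᵥ adj G *ᵥ f) (hg0 : 0 ≤ g) (hg1 : g ≠ 0)
    (hg : lam * (g ⬝ᵥ g) ≤ g ⬝ᵥ adj G *ᵥ g) (hfg : f ⬝ᵥ g = 0) (hfAg : f ⬝ᵥ adj G *ᵥ g = 0) :
    False := by
  have hs : ∑ i, g i ≠ 0 := by
    intro h0
    refine hg1 (funext fun i => ?_)
    exact (Finset.sum_eq_zero_iff_of_nonneg (fun i _ => hg0 i)).1 h0 i (Finset.mem_univ i)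
  set c := (∑ i, f i) / ∑ i, g i with hc
  have := h (f - c • g) (by
    simp only [Pi.sub_apply, Pi.smul_apply, smul_eq_mul, Finset.sum_sub_distrib, ← Finset.mul_sum]
    rw [hc, div_mul_cancel₀ _ hs, sub_self])
  have hgf : g ⬝ᵥ f = 0 := by rw [dotProduct_comm, hfg]
  have hgAf : g ⬝ᵥ adj G *ᵥ f = 0 := by rw [adj_form_comm, hfAg]
  simp only [Matrix.mulVec_sub, Matrix.mulVec_smul, sub_dotProduct, dotProduct_sub,
    smul_dotProduct, dotProduct_smul, smul_eq_mul, hfg, hfAg, hgf, hgAf] at this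
  nlinarith [mul_le_mul_of_nonneg_left hg (mul_self_nonneg c)]

theorem eigen_form {lam : ℝ} {y : V → ℝ} (hy : adj G *ᵥ y = lam • y) :
    y ⬝ᵥ adj G *ᵥ y = lam * (y ⬝ᵥ y) := by
  rw [hy, dotProduct_smul, smul_eq_mul]

/-- If the quadratic form is larger than `lam` on a vector supported on `S`, then the
`lam`-eigenvectors are determined by their values on `S` and its neighbours. -/
theorem SecondLe.determines {lam : ℝ} (h : SecondLe G lam) {f : V → ℝ} {S W : Finset V}
    (hf : lam * (f ⬝ᵥ f) < f ⬝ᵥ adj G *ᵥ f) (hfS : ∀ i, i ∉ S → f i = 0) (hSW : S ⊆ W)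
    (hSN : ∀ i ∈ S, ∀ j, G.Adj i j → j ∈ W) : Determines G lam W := by
  intro y hy hyW
  by_contra hy0
  -- Passing to `|y|` keeps the length, does not decrease the form, and gives the required
  -- nonnegativity.
  refine h.false_of_two (g := |y|) hf (abs_nonneg y) (by simpa using hy0) ?_ ?_ ?_
  · rw [abs_dotProduct_abs, ← eigen_form hy]
    exact adj_form_abs G y
  · refine Finset.sum_eq_zero fun i _ => ?_
    by_cases hi : i ∈ S
    · rw [Pi.abs_apply, hyW i (hSW hi)]; simp
    · rw [hfS i hi, zero_mul]
  · refine Finset.sum_eq_zero fun i _ => ?_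
    by_cases hi : i ∈ S
    · rw [adj_mulVec, Finset.sum_eq_zero, mul_zero]
      intro j hj
      rw [Pi.abs_apply, hyW j (hSN i hi j (Finset.mem_filter.1 hj).2), abs_zero]
    · rw [hfS i hi, zero_mul]

/-! ### Brooms have large spectral radius -/

/-- The weights, decaying geometrically with ratio `r`, on a path of length `2 * m` and `s` on a
pendant vertex at its middle, give a vector on which the quadratic form is large. -/
theorem exists_large_form_of_path {r s μ : ℝ} (hr0 : 0 < r) (hs0 : 0 ≤ s)
    (h1 : r * μ = 1 + r ^ 2) (h2 : 2 * r + s = μ) (h3 : μ * s = 1) {m : ℕ}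
    {p : ℕ → V} (hp : Set.InjOn p (Set.Iic (2 * m))) (hpa : ∀ i < 2 * m, G.Adj (p i) (p (i + 1)))
    {q : V} (hq : ∀ i ≤ 2 * m, p i ≠ q) (hqa : G.Adj (p m) q) :
    ∃ f : V → ℝ, (∀ i, i ∉ insert q ((range (2 * m + 1)).image p) → f i = 0) ∧
      1 ≤ f ⬝ᵥ f ∧ μ * (f ⬝ᵥ f) - 2 * r ^ (2 * m + 1) ≤ f ⬝ᵥ adj G *ᵥ f := by
  -- With truncated subtraction this is `|i - m|`, the distance to the middle.
  set e : ℕ → ℕ := fun i => (i - m) + (m - i) with he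
  set f : V → ℝ := fun w => if w = q then s else
    if h : ∃ i ≤ 2 * m, p i = w then r ^ (e h.choose) else 0 with hfdef
  have fq : f q = s := by simp [hfdef]
  have fp : ∀ i ≤ 2 * m, f (p i) = r ^ (e i) := by
    intro i hi
    have hex : ∃ j ≤ 2 * m, p j = p i := ⟨i, hi, rfl⟩
    have : hex.choose = i := hp hex.choose_spec.1 hi hex.choose_spec.2
    simp only [hfdef]
    rw [if_neg (hq i hi), dif_pos hex, this]
  have fout : ∀ w, w ∉ insert q ((range (2 * m + 1)).image p) → f w = 0 := by
    intro w hw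
    rw [Finset.mem_insert, Finset.mem_image, not_or] at hw
    simp only [hfdef]
    rw [if_neg hw.1, dif_neg]
    rintro ⟨i, hi, rfl⟩
    exact hw.2 ⟨i, Finset.mem_range.2 (by omega), rfl⟩
  have f0 : ∀ w, 0 ≤ f w := by
    intro w
    simp only [hfdef]
    split_ifs <;> positivity
  have nb : ∀ w, ∀ T : Finset V, (∀ x ∈ T, G.Adj w x) → ∑ x ∈ T, f x ≤ (adj G *ᵥ f) w := by
    intro w T hT
    rw [adj_mulVec]
    exact Finset.sum_le_sum_of_subset_of_nonneg
      (fun x hx => Finset.mem_filter.2 ⟨Finset.mem_univ x, hT x hx⟩) (fun x _ _ => f0 x)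
  have inj : ∀ i ≤ 2 * m, ∀ j ≤ 2 * m, i ≠ j → p i ≠ p j :=
    fun i hi j hj hij h => hij (hp hi hj h)
  have hpow : ∀ k, r ^ k + r ^ (k + 2) = μ * r ^ (k + 1) := by
    intro k
    calc r ^ k + r ^ (k + 2) = r ^ k * (1 + r ^ 2) := by ring
      _ = μ * r ^ (k + 1) := by rw [← h1]; ring
  -- The relations `h1`, `h2`, `h3` are the eigenvector equations along the infinite path, at its
  -- middle and at the pendant vertex. `g` is the neighbour's weight missing at the two ends; for `m
  -- = 0` the ends coincide and both terms count.
  set g : V → ℝ := fun w => (if w = p 0 then r ^ (m + 1) else 0) +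
    (if w = p (2 * m) then r ^ (m + 1) else 0) with hg
  have hg0 : ∀ w, 0 ≤ g w := by
    intro w; simp only [hg]; split_ifs <;> positivity
  have main : ∀ w, f w * (μ * f w - g w) ≤ f w * (adj G *ᵥ f) w := by
    intro w
    by_cases hw : w ∈ insert q ((range (2 * m + 1)).image p)
    swap
    · rw [fout w hw]; simp
    refine mul_le_mul_of_nonneg_left ?_ (f0 w)
    rw [Finset.mem_insert, Finset.mem_image] at hw
    rcases hw with rfl | ⟨i, hi, rfl⟩
    · have := nb w {p m} (by simpa using hqa.symm)
      rw [Finset.sum_singleton, fp m (by omega)] at this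
      have h5 : e m = 0 := by simp [he]
      rw [h5, pow_zero] at this
      rw [fq, h3]
      linarith [hg0 w]
    · have hi' : i ≤ 2 * m := by rw [Finset.mem_range] at hi; omega
      rw [fp i hi']
      by_cases hm : m = 0
      · subst hm
        obtain rfl : i = 0 := by omega
        have := nb (p 0) {q} (by simpa using hqa)
        rw [Finset.sum_singleton, fq] at this
        simp only [hg, he]
        simp
        linarith
      rcases Nat.lt_trichotomy i m with him | him | him
      · by_cases hi0 : i = 0
        · subst hi0
          have := nb (p 0) {p 1} (by simpa using hpa 0 (by omega))
          rw [Finset.sum_singleton, fp 1 (by omega)] at this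
          have e0 : e 0 = m - 1 + 1 := by simp [he]; omega
          have e1 : e 1 = m - 1 := by simp [he]; omega
          have := hpow (m - 1)
          have gg : r ^ (m + 1) ≤ g (p 0) := by
            simp only [hg, if_true]
            split_ifs <;> simp; positivity
          rw [e0, ← this]
          have : m - 1 + 2 = m + 1 := by omega
          rw [this, ← e1]
          linarith
        · have := nb (p i) {p (i - 1), p (i + 1)} (by
            intro x hx
            rw [Finset.mem_insert, Finset.mem_singleton] at hx
            rcases hx with rfl | rfl
            · have := hpa (i - 1) (by omega)
              rw [Nat.sub_add_cancel (by omega)] at this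
              exact this.symm
            · exact hpa i (by omega))
          rw [Finset.sum_pair (inj _ (by omega) _ (by omega) (by omega)), fp _ (by omega),
            fp _ (by omega)] at this
          have e1 : e (i - 1) = (m - i - 1) + 2 := by simp only [he]; omega
          have e2 : e (i + 1) = (m - i - 1) := by simp only [he]; omega
          have e3 : e i = (m - i - 1) + 1 := by simp only [he]; omega
          rw [e1, e2] at this
          rw [e3, ← hpow]
          linarith [hg0 (p i)]
      · subst him
        have := nb (p i) {q, p (i - 1), p (i + 1)} (by
            intro x hx
            rw [Finset.mem_insert, Finset.mem_insert, Finset.mem_singleton] at hx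
            rcases hx with rfl | rfl | rfl
            · exact hqa
            · have := hpa (i - 1) (by omega)
              rw [Nat.sub_add_cancel (by omega)] at this
              exact this.symm
            · exact hpa i (by omega))
        rw [Finset.sum_insert, Finset.sum_pair (inj _ (by omega) _ (by omega) (by omega)),
            fp _ (by omega), fp _ (by omega), fq] at this
        · have e1 : e (i - 1) = 1 := by simp only [he]; omega
          have e2 : e (i + 1) = 1 := by simp only [he]; omega
          have e3 : e i = 0 := by simp only [he]; omega
          rw [e1, e2] at this
          rw [e3]
          linarith [hg0 (p i)]
        · rw [Finset.mem_insert, Finset.mem_singleton, not_or]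
          exact ⟨(hq _ (by omega)).symm, (hq _ (by omega)).symm⟩
      · by_cases hi0 : i = 2 * m
        · subst hi0
          have := nb (p (2 * m)) {p (2 * m - 1)} (by
            have := hpa (2 * m - 1) (by omega)
            rw [Nat.sub_add_cancel (by omega)] at this
            simpa using this.symm)
          rw [Finset.sum_singleton, fp _ (by omega)] at this
          have e0 : e (2 * m) = m - 1 + 1 := by simp only [he]; omega
          have e1 : e (2 * m - 1) = m - 1 := by simp only [he]; omega
          have := hpow (m - 1)
          have gg : r ^ (m + 1) ≤ g (p (2 * m)) := by
            simp only [hg, if_true]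
            split_ifs <;> simp; positivity
          rw [e0, ← this]
          have : m - 1 + 2 = m + 1 := by omega
          rw [this, ← e1]
          linarith
        · have := nb (p i) {p (i - 1), p (i + 1)} (by
            intro x hx
            rw [Finset.mem_insert, Finset.mem_singleton] at hx
            rcases hx with rfl | rfl
            · have := hpa (i - 1) (by omega)
              rw [Nat.sub_add_cancel (by omega)] at this
              exact this.symm
            · exact hpa i (by omega))
          rw [Finset.sum_pair (inj _ (by omega) _ (by omega) (by omega)), fp _ (by omega),
            fp _ (by omega)] at this
          have e1 : e (i - 1) = (i - m - 1) := by simp only [he]; omega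
          have e2 : e (i + 1) = (i - m - 1) + 2 := by simp only [he]; omega
          have e3 : e i = (i - m - 1) + 1 := by simp only [he]; omega
          rw [e1, e2] at this
          rw [e3, ← hpow]
          linarith [hg0 (p i)]
  refine ⟨f, fout, ?_, ?_⟩
  · have : f (p m) * f (p m) ≤ f ⬝ᵥ f :=
      Finset.single_le_sum (f := fun w => f w * f w) (fun w _ => mul_self_nonneg _)
        (Finset.mem_univ (p m))
    rw [fp m (by omega)] at this
    have h5 : e m = 0 := by simp [he]
    simpa [h5] using this
  · have h6 := Finset.sum_le_sum (s := univ) (fun w _ => main w)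
    have h7 : ∑ w, f w * (μ * f w - g w) = μ * (f ⬝ᵥ f) - 2 * r ^ (2 * m + 1) := by
      have e0 : e 0 = m := by simp [he]
      have e1 : e (2 * m) = m := by simp only [he]; omega
      have : ∀ w, f w * (μ * f w - g w) = μ * (f w * f w)
          - ((if w = p 0 then f w * r ^ (m + 1) else 0) +
            (if w = p (2 * m) then f w * r ^ (m + 1) else 0)) := by
        intro w; simp only [hg]; split_ifs <;> ring
      simp only [this, Finset.sum_sub_distrib, Finset.sum_add_distrib, ← Finset.mul_sum,
        Finset.sum_ite_eq', Finset.mem_univ, if_true, fp 0 (by omega), fp (2 * m) le_rfl, e0, e1]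
      simp only [dotProduct]
      ring
    rw [h7] at h6
    exact h6

end AdjForm

/-- If `lam < √(2 + √5)`, then a long path with a pendant vertex at its middle has spectral radius
larger than `lam`. -/
theorem exists_path_length {lam : ℝ} (hlam : lam < √(2 + √5)) : ∃ m : ℕ, 1 ≤ m ∧
    ∀ {V : Type} [Fintype V] [DecidableEq V] {G : SimpleGraph V} {p : ℕ → V},
      Set.InjOn p (Set.Iic (2 * m)) → (∀ i < 2 * m, G.Adj (p i) (p (i + 1))) →
      ∀ {q : V}, (∀ i ≤ 2 * m, p i ≠ q) → G.Adj (p m) q →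
      ∃ f : V → ℝ, (∀ i, i ∉ insert q ((range (2 * m + 1)).image p) → f i = 0) ∧
        lam * dotProduct f f < dotProduct f (Matrix.mulVec (adj G) f) := by
  set μ := √(2 + √5) with hμ
  have h5 : √5 ^ 2 = 5 := Real.sq_sqrt (by norm_num)
  have h5' : 2 < √5 := by
    rw [Real.lt_sqrt (by norm_num)]; norm_num
  have hμ2 : μ ^ 2 = 2 + √5 := Real.sq_sqrt (by positivity)
  have hμ0 : 0 < μ := by positivity
  -- With the golden ratio `φ`: `r² = 1/φ` and `μ² = φ³`.
  set r := √((√5 - 1) / 2) with hr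
  have hr2 : r ^ 2 = (√5 - 1) / 2 := Real.sq_sqrt (by linarith)
  have hr0 : 0 < r := Real.sqrt_pos.2 (by linarith)
  have h53 : √5 < 3 := by
    rw [Real.sqrt_lt' (by norm_num)]; norm_num
  have hr1 : r < 1 := by nlinarith
  have h1 : r * μ = 1 + r ^ 2 := by
    have : (r * μ) ^ 2 = (1 + r ^ 2) ^ 2 := by
      rw [mul_pow, hμ2, hr2]; nlinarith
    exact (sq_eq_sq₀ (by positivity) (by positivity)).1 this
  have h3 : μ * (1 / μ) = 1 := by field_simp
  have h2 : 2 * r + 1 / μ = μ := by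
    have : μ * (2 * r + 1 / μ) = μ * μ := by
      rw [mul_add, h3, ← pow_two, hμ2]; nlinarith
    exact mul_left_cancel₀ hμ0.ne' this
  -- The truncation loss `2 r ^ (2m+3)` of the broom with parameter `m + 1` is then below `μ - lam`,
  -- and `f ⬝ᵥ f ≥ 1`.
  obtain ⟨m, hm⟩ := exists_pow_lt_of_lt_one (show 0 < (μ - lam) / 2 by linarith) hr1
  refine ⟨m + 1, by omega, fun {V} _ _ {G p} hp hpa {q} hq hqa => ?_⟩
  obtain ⟨f, hf, hff, hfA⟩ :=
    exists_large_form_of_path hr0 (by positivity) h1 h2 h3 hp hpa hq hqa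
  refine ⟨f, fun i hi => hf i (by convert hi), ?_⟩
  have : r ^ (2 * (m + 1) + 1) ≤ r ^ m := pow_le_pow_of_le_one hr0.le hr1.le (by omega)
  nlinarith

/-! ### Components without long brooms -/

section Neighbourhood

open scoped Classical Matrix

variable {V : Type} [Fintype V] (G : SimpleGraph V)

/-- The closed neighbourhood of a set of vertices. -/
noncomputable def hull (S : Finset V) : Finset V := S ∪ S.biUnion (fun v => univ.filter (G.Adj v))

/-- All degrees are at most `Δ`. -/
def DegLe (Δ : ℕ) : Prop := ∀ v, (univ.filter (G.Adj v)).card ≤ Δ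

variable {G}

theorem card_hull_le {Δ : ℕ} (h : DegLe G Δ) (S : Finset V) :
    (hull G S).card ≤ (Δ + 1) * S.card := by
  have h1 : (S.biUnion (fun v => univ.filter (G.Adj v))).card ≤ S.card * Δ :=
    Finset.card_biUnion_le_card_mul _ _ _ (fun v _ => h v)
  have h2 := Finset.card_union_le S (S.biUnion (fun v => univ.filter (G.Adj v)))
  rw [hull]; linarith

theorem card_hull_iterate_le {Δ : ℕ} (h : DegLe G Δ) (S : Finset V) (k : ℕ) :
    ((hull G)^[k] S).card ≤ (Δ + 1) ^ k * S.card := by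
  induction k with
  | zero => simp
  | succ k ih =>
    rw [Function.iterate_succ_apply', pow_succ']
    calc _ ≤ (Δ + 1) * ((hull G)^[k] S).card := card_hull_le h _
      _ ≤ _ := by rw [mul_assoc]; gcongr

theorem subset_hull (S : Finset V) : S ⊆ hull G S := Finset.subset_union_left

theorem mem_hull_of_adj {S : Finset V} {u w : V} (hu : u ∈ S) (h : G.Adj u w) : w ∈ hull G S :=
  Finset.mem_union_right _ (Finset.mem_biUnion.2 ⟨u, hu, Finset.mem_filter.2 ⟨mem_univ _, h⟩⟩)

theorem hull_iterate_mono (S : Finset V) {k l : ℕ} (h : k ≤ l) :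
    (hull G)^[k] S ⊆ (hull G)^[l] S := by
  induction l, h using Nat.le_induction with
  | base => exact subset_rfl
  | succ l _ ih => rw [Function.iterate_succ_apply']; exact ih.trans (subset_hull _)

/-- A path of length `2 * m` with a pendant vertex at its middle. -/
def HasBroom (G : SimpleGraph V) (m : ℕ) : Prop :=
  ∃ p : ℕ → V, ∃ q, Set.InjOn p (Set.Iic (2 * m)) ∧ (∀ i < 2 * m, G.Adj (p i) (p (i + 1))) ∧
    (∀ i ≤ 2 * m, p i ≠ q) ∧ G.Adj (p m) q

/-- The parent map of a breadth-first tree rooted at `v`. Reachability is carried along because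
`SimpleGraph.dist` is `0` between different components. -/
theorem exists_parent (v : V) : ∃ par : V → V, ∀ w, G.Reachable v w → 0 < G.dist v w →
    G.Reachable v (par w) ∧ G.Adj (par w) w ∧ G.dist v (par w) + 1 = G.dist v w := by
  have : ∀ w, ∃ u, G.Reachable v w → 0 < G.dist v w →
      G.Reachable v u ∧ G.Adj u w ∧ G.dist v u + 1 = G.dist v w := by
    intro w
    by_cases h : G.Reachable v w ∧ 0 < G.dist v w
    swap
    · exact ⟨v, fun h1 h2 => absurd ⟨h1, h2⟩ h⟩
    obtain ⟨hr, hd⟩ := h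
    obtain ⟨P, hP⟩ := hr.symm.exists_walk_length_eq_dist
    rw [SimpleGraph.dist_comm] at hP
    cases P with
    | nil => rw [← hP] at hd; simp at hd
    | cons hadj Q =>
      rename_i u
      rw [SimpleGraph.Walk.length_cons] at hP
      refine ⟨u, fun _ _ => ⟨⟨Q.reverse⟩, hadj.symm, ?_⟩⟩
      have h1 := SimpleGraph.dist_le Q
      rw [SimpleGraph.dist_comm] at h1
      have h2 : G.dist v w ≤ G.dist v u + 1 := by
        obtain ⟨P', hP'⟩ := (Q.reverse.reachable).exists_walk_length_eq_dist
        rw [← hP']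
        have := SimpleGraph.dist_le (P'.concat hadj.symm)
        rwa [SimpleGraph.Walk.length_concat] at this
      omega
  choose par h using this
  exact ⟨par, h⟩

omit [Fintype V] in
theorem dist_le_succ_of_adj {v u w : V} (hu : G.Reachable v u) (h : G.Adj u w) :
    G.dist v w ≤ G.dist v u + 1 := by
  obtain ⟨P', hP'⟩ := hu.exists_walk_length_eq_dist
  rw [← hP']
  have := SimpleGraph.dist_le (P'.concat h)
  rwa [SimpleGraph.Walk.length_concat] at this

/-- In a graph of bounded degree without long brooms, the eigenvectors are determined
on a connected component by boundedly many values. -/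
theorem exists_determining_of_not_hasBroom {Δ m : ℕ} (hm : 1 ≤ m) (hΔ : DegLe G Δ)
    (hG : ¬ HasBroom G m) (v : V) : ∃ W : Finset V,
      W.card ≤ (Δ + 1) ^ (2 * m + 1) + (Δ + 1) ^ m * (Δ + 1) ^ m ∧
      ∀ (lam : ℝ) (y : V → ℝ), adj G *ᵥ y = lam • y → (∀ w ∈ W, y w = 0) →
        ∀ w, G.Reachable v w → y w = 0 := by
  obtain ⟨par, hpar⟩ := exists_parent (G := G) v
  set ℓ : V → ℕ := G.dist v with hℓ
  have iter : ∀ i w, G.Reachable v w → i ≤ ℓ w →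
      G.Reachable v (par^[i] w) ∧ ℓ (par^[i] w) + i = ℓ w := by
    intro i
    induction i with
    | zero => intro w hw _; exact ⟨hw, rfl⟩
    | succ i ih =>
      intro w hw hi
      obtain ⟨h1, h2⟩ := ih w hw (by omega)
      obtain ⟨h3, -, h4⟩ := hpar _ h1 (by omega)
      change ℓ _ + 1 = ℓ _ at h4
      rw [Function.iterate_succ_apply']
      exact ⟨h3, by omega⟩
  have iter_adj : ∀ i w, G.Reachable v w → i < ℓ w → G.Adj (par^[i + 1] w) (par^[i] w) := by
    intro i w hw hi
    obtain ⟨h1, h2⟩ := iter i w hw hi.le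
    rw [Function.iterate_succ_apply']
    exact (hpar _ h1 (by omega)).2.1
  -- Deep vertices have a descendant `m` levels below them in the tree.
  set deep : V → Prop := fun u => ∃ w, G.Reachable v w ∧ ℓ w = ℓ u + m ∧ par^[m] w = u with hdeep
  have deep_par : ∀ u, G.Reachable v u → 0 < ℓ u → deep u → deep (par u) := by
    rintro u hu hu0 ⟨w, hw, h1, h2⟩
    have h3 := (hpar _ hu hu0).2.2
    have h4 := hpar w hw (by omega)
    refine ⟨par w, h4.1, ?_, ?_⟩
    · change ℓ _ + 1 = ℓ _ at h3
      have := h4.2.2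
      change ℓ _ + 1 = ℓ _ at this
      omega
    · rw [← h2, ← Function.iterate_succ_apply, Function.iterate_succ_apply']
  have nbrs : ∀ u, G.Reachable v u → m ≤ ℓ u → deep u →
      ∃ c, ∀ q, G.Adj u q → q = par u ∨ q = c := by
    rintro u hu hum ⟨w, hw, h1, h2⟩
    refine ⟨par^[m - 1] w, fun q hq => ?_⟩
    -- The tree path from `w` through `u`, `m` levels further up, with `q` attached at `u`, would be
    -- a broom. Levels of adjacent vertices differ by at most one, so `q` can meet the path only at
    -- `u`, its parent or its child.
    by_contra hcon
    rw [not_or] at hcon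
    refine hG ⟨fun i => par^[i] w, q, ?_, ?_, ?_, ?_⟩
    · intro i hi j hj hij
      simp only [Set.mem_Iic] at hi hj hij
      have hi' := (iter i w hw (by omega)).2
      have hj' := (iter j w hw (by omega)).2
      rw [hij] at hi'
      omega
    · intro i hi
      exact (iter_adj i w hw (by omega)).symm
    · intro i hi hiq
      have hi' := (iter i w hw (by omega)).2
      simp only at hiq
      rw [hiq] at hi'
      have hq1 := dist_le_succ_of_adj hu hq
      have hq2 := dist_le_succ_of_adj (hu.trans hq.reachable) hq.symm
      change ℓ _ ≤ ℓ _ + 1 at hq1 hq2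
      have : i = m - 1 ∨ i = m ∨ i = m + 1 := by omega
      rcases this with rfl | rfl | rfl
      · exact hcon.2 hiq.symm
      · rw [h2] at hiq; exact hq.ne hiq
      · rw [Function.iterate_succ_apply', h2] at hiq; exact hcon.1 hiq.symm
    · simp only [h2]; exact hq
  have uniq : ∀ u, G.Reachable v u → m ≤ ℓ u → deep u → ∀ c₁ c₂, G.Adj u c₁ → G.Adj u c₂ →
      ℓ c₁ = ℓ u + 1 → ℓ c₂ = ℓ u + 1 → c₁ = c₂ := by
    intro u hu hum hud c₁ c₂ h₁ h₂ e₁ e₂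
    obtain ⟨c, hc⟩ := nbrs u hu hum hud
    have hp := (hpar u hu (by omega)).2.2
    change ℓ _ + 1 = ℓ _ at hp
    rcases hc c₁ h₁ with rfl | rfl
    · omega
    rcases hc c₂ h₂ with rfl | rfl
    · omega
    rfl
  -- From level `m` on, the deep vertices form disjoint descending paths; `E` is the set of their
  -- lower ends.
  set E : Finset V := univ.filter (fun t => G.Reachable v t ∧ m ≤ ℓ t ∧ deep t ∧
    ∀ c, G.Adj t c → ℓ c = ℓ t + 1 → ¬ deep c) with hE
  have memball : ∀ w, G.Reachable v w → ∀ k, ℓ w ≤ k → w ∈ (hull G)^[k] {v} := by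
    intro w hw k hk
    refine hull_iterate_mono _ hk ?_
    generalize hn : ℓ w = n
    induction n generalizing w with
    | zero =>
      have : v = w := (hw.dist_eq_zero_iff).1 hn
      simp [this]
    | succ n ih =>
      obtain ⟨h1, h2, h3⟩ := hpar w hw (by omega)
      change ℓ _ + 1 = ℓ _ at h3
      rw [Function.iterate_succ_apply']
      exact mem_hull_of_adj (ih _ h1 (by omega) (by omega)) h2
  have deep_iter : ∀ i w, G.Reachable v w → i ≤ ℓ w → deep w → deep (par^[i] w) := by
    intro i
    induction i with
    | zero => intro w _ _ h; exact h
    | succ i ih =>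
      intro w hw hi h
      obtain ⟨h1, h2⟩ := iter i w hw (by omega)
      rw [Function.iterate_succ_apply']
      exact deep_par _ h1 (by omega) (ih w hw (by omega) h)
  -- An end is determined by its ancestor at level `m`: going down from there, each deep vertex has
  -- only one child.
  have Einj : ∀ t ∈ E, ∀ t' ∈ E, ℓ t ≤ ℓ t' → par^[ℓ t - m] t = par^[ℓ t' - m] t' → t = t' := by
    intro t ht t' ht' hle heq
    obtain ⟨-, hr, htm, htd, htE⟩ := Finset.mem_filter.1 ht
    obtain ⟨-, hr', htm', htd', htE'⟩ := Finset.mem_filter.1 ht'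
    have claim : ∀ i ≤ ℓ t - m, par^[ℓ t - m - i] t = par^[ℓ t' - m - i] t' := by
      intro i
      induction i with
      | zero => intro _; exact heq
      | succ i ih =>
        intro hi
        have h0 := ih (by omega)
        have a1 := iter_adj (ℓ t - m - (i + 1)) t hr (by omega)
        have a2 := iter_adj (ℓ t' - m - (i + 1)) t' hr' (by omega)
        rw [show ℓ t - m - (i + 1) + 1 = ℓ t - m - i by omega] at a1
        rw [show ℓ t' - m - (i + 1) + 1 = ℓ t' - m - i by omega, ← h0] at a2
        have b0 := iter (ℓ t - m - i) t hr (by omega)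
        have b1 := iter (ℓ t - m - (i + 1)) t hr (by omega)
        have b2 := iter (ℓ t' - m - (i + 1)) t' hr' (by omega)
        exact uniq _ b0.1 (by omega) (deep_iter _ _ hr (by omega) htd) _ _ a1 a2
          (by omega) (by omega)
    have h1 := claim (ℓ t - m) le_rfl
    rw [Nat.sub_self, Function.iterate_zero_apply,
      show ℓ t' - m - (ℓ t - m) = ℓ t' - ℓ t by omega] at h1
    rcases Nat.eq_or_lt_of_le hle with h | h
    · rw [h, Nat.sub_self, Function.iterate_zero_apply] at h1
      exact h1
    · exfalso
      have a := iter_adj (ℓ t' - ℓ t - 1) t' hr' (by omega)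
      rw [show ℓ t' - ℓ t - 1 + 1 = ℓ t' - ℓ t by omega, ← h1] at a
      have b := iter (ℓ t' - ℓ t - 1) t' hr' (by omega)
      exact htE _ a (by omega) (deep_iter _ _ hr' (by omega) htd')
  have Ecard : E.card ≤ (Δ + 1) ^ m := by
    calc E.card ≤ ((hull G)^[m] {v}).card := by
          refine Finset.card_le_card_of_injOn (fun t => par^[ℓ t - m] t) ?_ ?_
          · intro t ht
            obtain ⟨-, hr, htm, -, -⟩ := Finset.mem_filter.1 ht
            have b := iter (ℓ t - m) t hr (by omega)
            exact memball _ b.1 _ (by omega)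
          · intro t ht t' ht' h
            rcases le_total (ℓ t) (ℓ t') with hle | hle
            · exact Einj t ht t' ht' hle h
            · exact (Einj t' ht' t ht hle h.symm).symm
      _ ≤ (Δ + 1) ^ m * ({v} : Finset V).card := card_hull_iterate_le hΔ _ _
      _ = (Δ + 1) ^ m := by simp
  -- A ball around the root, together with everything within `m` of an end of a bare path.
  refine ⟨(hull G)^[2 * m + 1] {v} ∪ (hull G)^[m] E, ?_, ?_⟩
  · refine (Finset.card_union_le _ _).trans (Nat.add_le_add ?_ ?_)
    · simpa using card_hull_iterate_le hΔ {v} (2 * m + 1)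
    · exact (card_hull_iterate_le hΔ E m).trans (Nat.mul_le_mul_left _ Ecard)
  intro lam y hy hyW w hw
  induction hn : ℓ w using Nat.strong_induction_on generalizing w with
  | _ n ih =>
    by_cases hwW : w ∈ (hull G)^[2 * m + 1] {v} ∪ (hull G)^[m] E
    · exact hyW w hwW
    rw [Finset.mem_union, not_or] at hwW
    have hlw : 2 * m + 1 < ℓ w := by
      by_contra h
      exact hwW.1 (memball w hw _ (by omega))
    have hdm : ∃ i, i ≤ m ∧ deep (par^[i] w) :=
      ⟨m, le_rfl, w, hw, (iter m w hw (by omega)).2.symm, rfl⟩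
    -- If the first deep vertex on the way up from `w` came only after two or more steps, its unique
    -- child would not be deep, so it would be in `E` and `w` within `m` of it.
    have hd1 : deep (par w) := by
      set i := Nat.find hdm with hi
      obtain ⟨him, hid⟩ := Nat.find_spec hdm
      rw [← hi] at him hid
      rcases Nat.lt_or_ge i 2 with h2 | h2
      · interval_cases i
        · exact deep_par _ hw (by omega) hid
        · exact hid
      · exfalso
        have hmin := Nat.find_min hdm (m := i - 1) (by omega)
        have hnd : ¬ deep (par^[i - 1] w) := fun h => hmin ⟨by omega, h⟩
        have b := iter i w hw (by omega)
        have b1 := iter (i - 1) w hw (by omega)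
        have a1 := iter_adj (i - 1) w hw (by omega)
        rw [show i - 1 + 1 = i by omega] at a1
        have hmem : par^[i] w ∈ E := by
          refine Finset.mem_filter.2 ⟨mem_univ _, b.1, by omega, hid, fun c hc hcl => ?_⟩
          rw [uniq _ b.1 (by omega) hid c _ hc a1 hcl (by omega)]
          exact hnd
        have : ∀ j ≤ i, par^[i - j] w ∈ (hull G)^[j] E := by
          intro j
          induction j with
          | zero => intro _; exact hmem
          | succ j ihj =>
            intro hj
            have a2 := iter_adj (i - (j + 1)) w hw (by omega)
            rw [show i - (j + 1) + 1 = i - j by omega] at a2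
            rw [Function.iterate_succ_apply']
            exact mem_hull_of_adj (ihj (by omega)) a2
        have h3 := this i le_rfl
        rw [Nat.sub_self] at h3
        exact hwW.2 (hull_iterate_mono _ him h3)
    obtain ⟨hpr, hpa, hpl⟩ := hpar w hw (by omega)
    obtain ⟨hppr, -, hppl⟩ := hpar (par w) hpr (by change ℓ _ + 1 = ℓ _ at hpl; omega)
    change ℓ _ + 1 = ℓ _ at hpl hppl
    have y1 : y (par w) = 0 := ih _ (by omega) (par w) hpr rfl
    have y2 : y (par (par w)) = 0 := ih _ (by omega) (par (par w)) hppr rfl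
    have h4 := congrFun hy (par w)
    rw [adj_mulVec, Pi.smul_apply, y1, smul_zero] at h4
    obtain ⟨c, hc⟩ := nbrs _ hpr (by omega) hd1
    -- `par w` has no neighbours besides `w` and `par (par w)`, so the eigenvector equation at `par
    -- w` reads `y w = 0`.
    rw [← h4, eq_comm]
    refine Finset.sum_eq_single_of_mem w (Finset.mem_filter.2 ⟨mem_univ _, hpa⟩) (fun q hq hqw => ?_)
    have hq := (Finset.mem_filter.1 hq).2
    rcases hc q hq with rfl | rfl
    · exact y2
    · rcases hc w hpa with h | h
      · rw [← h] at hppl; omega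
      · exact absurd h.symm hqw

end Neighbourhood

/-! ### Eigenvectors on connected components -/

section Components

open scoped Classical Matrix

theorem hasEigenvalue_iff {V : Type} [Fintype V] {G : SimpleGraph V} {μ : ℝ} :
    Module.End.HasEigenvalue (Matrix.toLin' (G.adjMatrix ℝ)) μ ↔
      ∃ x : V → ℝ, x ≠ 0 ∧ adj G *ᵥ x = μ • x := by
  constructor
  · intro h
    obtain ⟨x, hx⟩ := h.exists_hasEigenvector
    refine ⟨x, hx.2, ?_⟩
    have := hx.apply_eq_smul
    rwa [Matrix.toLin'_apply] at this
  · rintro ⟨x, hx0, hx⟩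
    refine Module.End.hasEigenvalue_of_hasEigenvector (x := x) ⟨?_, hx0⟩
    rw [Module.End.mem_eigenspace_iff, Matrix.toLin'_apply]
    exact hx

theorem hasSpectralRadius_iff {V : Type} [Fintype V] {G : SimpleGraph V} {μ : ℝ} :
    HasSpectralRadius G μ ↔ (∃ x : V → ℝ, x ≠ 0 ∧ adj G *ᵥ x = μ • x) ∧
      ∀ ν : ℝ, ∀ x : V → ℝ, x ≠ 0 → adj G *ᵥ x = ν • x → ν ≤ μ := by
  constructor
  · rintro ⟨h1, h2⟩
    exact ⟨hasEigenvalue_iff.1 h1, fun ν x hx h => h2 (hasEigenvalue_iff.2 ⟨x, hx, h⟩)⟩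
  · rintro ⟨h1, h2⟩
    refine ⟨hasEigenvalue_iff.2 h1, fun ν hν => ?_⟩
    obtain ⟨x, hx, h⟩ := hasEigenvalue_iff.1 hν
    exact h2 ν x hx h

variable {V : Type} [Fintype V] {G : SimpleGraph V}

/-- A vector is supported on a connected component. -/
def SuppOn (c : G.ConnectedComponent) (f : V → ℝ) : Prop :=
  ∀ w, G.connectedComponentMk w ≠ c → f w = 0

theorem adj_mulVec_eq_of_eqOn {c : G.ConnectedComponent} {f g : V → ℝ}
    (h : ∀ w, G.connectedComponentMk w = c → f w = g w) {w : V}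
    (hw : G.connectedComponentMk w = c) : (adj G *ᵥ f) w = (adj G *ᵥ g) w := by
  rw [adj_mulVec, adj_mulVec]
  refine Finset.sum_congr rfl fun j hj => h j ?_
  rw [← hw, eq_comm]
  exact SimpleGraph.ConnectedComponent.sound (Finset.mem_filter.1 hj).2.reachable

theorem suppOn_adj_mulVec {c : G.ConnectedComponent} {f : V → ℝ} (hf : SuppOn c f) :
    SuppOn c (adj G *ᵥ f) := by
  intro w hw
  rw [adj_mulVec]
  refine Finset.sum_eq_zero fun j hj => hf j ?_
  rwa [← SimpleGraph.ConnectedComponent.sound (Finset.mem_filter.1 hj).2.reachable]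

theorem SuppOn.dotProduct_eq_zero {c c' : G.ConnectedComponent} (hc : c ≠ c') {f g : V → ℝ}
    (hf : SuppOn c f) (hg : SuppOn c' g) : f ⬝ᵥ g = 0 := by
  refine Finset.sum_eq_zero fun w _ => ?_
  by_cases hw : G.connectedComponentMk w = c
  · rw [hg w (hw ▸ hc), mul_zero]
  · rw [hf w hw, zero_mul]

omit [Fintype V] in
theorem SuppOn.abs {c : G.ConnectedComponent} {f : V → ℝ} (hf : SuppOn c f) : SuppOn c |f| :=
  fun w hw => by rw [Pi.abs_apply, hf w hw, abs_zero]

/-- The spectral radius of the component exceeds `lam`. -/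
def Exceeds (lam : ℝ) (c : G.ConnectedComponent) : Prop :=
  ∃ f : V → ℝ, SuppOn c f ∧ lam * (f ⬝ᵥ f) < f ⬝ᵥ adj G *ᵥ f

/-- Vectors on different components are orthogonal for both the dot product and the adjacency form,
so `SecondLe.false_of_two` applies. -/
theorem SecondLe.exceeds_unique {lam : ℝ} (h : SecondLe G lam) {c c' : G.ConnectedComponent}
    (hc : Exceeds lam c) (hc' : Exceeds lam c') : c = c' := by
  by_contra hne
  obtain ⟨f, hf, hfA⟩ := hc
  obtain ⟨g, hg, hgA⟩ := hc'
  refine h.false_of_two hfA (abs_nonneg g) ?_ ?_ (hf.dotProduct_eq_zero hne hg.abs)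
    (hf.dotProduct_eq_zero hne (suppOn_adj_mulVec hg.abs))
  · rintro h0
    have : g = 0 := by simpa using h0
    subst this
    simp at hgA
  · rw [abs_dotProduct_abs]
    exact hgA.le.trans (adj_form_abs G g)

/-- The restriction of a vector to a component. -/
noncomputable def restr (c : G.ConnectedComponent) (y : V → ℝ) : V → ℝ :=
  fun w => if G.connectedComponentMk w = c then y w else 0

omit [Fintype V] in
theorem suppOn_restr (c : G.ConnectedComponent) (y : V → ℝ) : SuppOn c (restr c y) :=
  fun _ hw => if_neg hw

theorem adj_mulVec_restr {lam : ℝ} {y : V → ℝ} (hy : adj G *ᵥ y = lam • y)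
    (c : G.ConnectedComponent) : adj G *ᵥ restr c y = lam • restr c y := by
  funext w
  by_cases hw : G.connectedComponentMk w = c
  · rw [adj_mulVec_eq_of_eqOn (f := restr c y) (g := y) (fun w hw => if_pos hw) hw, hy, Pi.smul_apply, Pi.smul_apply,
      restr, if_pos hw]
  · rw [suppOn_adj_mulVec (suppOn_restr c y) w hw, Pi.smul_apply, suppOn_restr c y w hw, smul_zero]

/-- An eigenvector for the spectral radius of a component that vanishes at one vertex of the
component vanishes on the whole component. -/
theorem eigenvector_vanishes {lam : ℝ} (hlam : 0 < lam) {c : G.ConnectedComponent}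
    (hc : ¬ Exceeds lam c) {y : V → ℝ} (hy : adj G *ᵥ y = lam • y) {v w : V}
    (hv : G.connectedComponentMk v = c) (hyv : y v = 0) (hvw : G.Reachable v w) : y w = 0 := by
  have step : ∀ u w, G.connectedComponentMk u = c → y u = 0 → G.Adj u w → y w = 0 := by
    intro u w hu hyu huw
    by_contra hyw
    have hw : G.connectedComponentMk w = c := by
      rw [← hu, eq_comm]; exact SimpleGraph.ConnectedComponent.sound huw.reachable
    set z : V → ℝ := |restr c y| with hz
    have hzc : SuppOn c z := (suppOn_restr c y).abs
    have hz1 : lam * (z ⬝ᵥ z) ≤ z ⬝ᵥ adj G *ᵥ z := by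
      rw [hz, abs_dotProduct_abs, ← eigen_form (adj_mulVec_restr hy c)]
      exact adj_form_abs G _
    set a := (adj G *ᵥ z) u with ha
    have ha0 : 0 < a := by
      have h1 : z w ≤ a := by
        rw [ha, adj_mulVec]
        exact Finset.single_le_sum (f := z) (fun i _ => abs_nonneg (restr c y i))
          (Finset.mem_filter.2 ⟨mem_univ w, huw⟩)
      have h2 : 0 < z w := by
        rw [hz, Pi.abs_apply, restr, if_pos hw]; exact abs_pos.2 hyw
      linarith
    have hzu : z u = 0 := by rw [hz, Pi.abs_apply, restr, if_pos hu, hyu, abs_zero]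
    apply hc
    -- Adding `b` at `u` changes the form minus `lam` times the squared length by `2ab - lam b²`,
    -- which is maximal and positive at `b = a / lam`.
    refine ⟨z + (a / lam) • Pi.single u 1, ?_, ?_⟩
    · intro i hi
      have : i ≠ u := by rintro rfl; exact hi hu
      simp [hzc i hi, this]
    · have e0 : (adj G *ᵥ (Pi.single u 1 : V → ℝ)) u = 0 := by
        rw [adj_mulVec]
        refine Finset.sum_eq_zero fun j hj => ?_
        have : j ≠ u := by rintro rfl; exact (Finset.mem_filter.1 hj).2.ne rfl
        simp [this]
      have e1 : z ⬝ᵥ adj G *ᵥ (Pi.single u 1 : V → ℝ) = a := by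
        rw [adj_form_comm, single_one_dotProduct]
      have hb : 0 < a / lam := by positivity
      have hab : a / lam * lam = a := div_mul_cancel₀ _ hlam.ne'
      simp only [Matrix.mulVec_add, Matrix.mulVec_smul, add_dotProduct, dotProduct_add,
        smul_dotProduct, dotProduct_smul, smul_eq_mul, e1, single_one_dotProduct, e0, hzu,
        dotProduct_single_one, Pi.add_apply, Pi.smul_apply, Pi.single_eq_same, ← ha]
      set b := a / lam
      rw [← hab]
      have : 0 < lam * (b * b) := by positivity
      nlinarith
  rw [SimpleGraph.reachable_iff_reflTransGen] at hvw
  have : G.connectedComponentMk w = c ∧ y w = 0 := by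
    induction hvw with
    | refl => exact ⟨hv, hyv⟩
    | tail _ hadj ih =>
      refine ⟨?_, step _ _ ih.1 ih.2 hadj⟩
      rw [← ih.1, eq_comm]
      exact SimpleGraph.ConnectedComponent.sound (SimpleGraph.Adj.reachable hadj)
  exact this.2

/-- A component whose spectral radius is `lam` gives a graph with spectral radius `lam`. -/
theorem hasSpectralRadius_comap {lam : ℝ} {c : G.ConnectedComponent}
    (hc : ¬ Exceeds lam c) {y : V → ℝ} (hy : adj G *ᵥ y = lam • y) {w : V}
    (hw : G.connectedComponentMk w = c) (hyw : y w ≠ 0) {j : ℕ}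
    (e : Fin j ≃ {w // G.connectedComponentMk w = c}) :
    HasSpectralRadius (G.comap (fun i => (e i : V))) lam := by
  have sum_eq : ∀ (f : V → ℝ) (i : Fin j),
      (adj (G.comap (fun i => (e i : V))) *ᵥ (fun i => f (e i))) i = (adj G *ᵥ f) (e i) := by
    intro f i
    rw [adj_mulVec, adj_mulVec]
    refine Finset.sum_bij (fun b _ => (e b : V)) ?_ ?_ ?_ ?_
    · intro b hb; simpa using hb
    · intro b _ b' _ h; exact e.injective (Subtype.ext h)
    · intro b hb
      have hb := (Finset.mem_filter.1 hb).2
      have hbc : G.connectedComponentMk b = c := by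
        rw [← (e i).2, eq_comm]
        exact SimpleGraph.ConnectedComponent.sound hb.reachable
      exact ⟨e.symm ⟨b, hbc⟩, by simpa using hb, by simp⟩
    · intros; rfl
  rw [hasSpectralRadius_iff]
  refine ⟨⟨fun i => y (e i), ?_, ?_⟩, ?_⟩
  · intro h
    have := congrFun h (e.symm ⟨w, hw⟩)
    simp at this
    exact hyw this
  · funext i
    rw [sum_eq, hy]; rfl
  · intro ν z hz0 hz
    -- Extended by zero, `z` is an eigenvector of `G` supported on `c`; with `ν > lam` it would show
    -- that `c` exceeds `lam`.
    set f : V → ℝ := fun w => if h : G.connectedComponentMk w = c then z (e.symm ⟨w, h⟩) else 0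
      with hf
    have hfz : (fun i => f (e i)) = z := by
      funext i
      simp [hf, (e i).2]
    have hfc : SuppOn c f := fun w hw => by simp [hf, hw]
    have hAf : adj G *ᵥ f = ν • f := by
      funext w
      by_cases hw : G.connectedComponentMk w = c
      · have h1 := sum_eq f (e.symm ⟨w, hw⟩)
        rw [hfz, hz] at h1
        simp only [Equiv.apply_symm_apply] at h1
        rw [← h1]
        simp [hf, hw]
      · rw [suppOn_adj_mulVec hfc w hw, Pi.smul_apply, hfc w hw, smul_zero]
    have hf0 : f ≠ 0 := by
      rintro h0
      apply hz0
      rw [← hfz, h0]; rfl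
    by_contra hlt
    refine hc ⟨f, hfc, ?_⟩
    rw [eigen_form hAf]
    have : 0 < f ⬝ᵥ f := by
      refine lt_of_le_of_ne (Finset.sum_nonneg fun i _ => mul_self_nonneg _) (Ne.symm ?_)
      rwa [Ne, dotProduct_self_eq_zero]
    exact mul_lt_mul_of_pos_right (not_le.1 hlt) this

end Components

/-! ### Small determining sets -/

section Determining

open scoped Classical Matrix

/-- The eigenvectors for `lam` are determined by few values. -/
theorem exists_determining {lam : ℝ} (hlam0 : 0 < lam) (hlam : lam < √(2 + √5)) (Δ : ℕ) :
    ∃ C : ℕ, ∀ {V : Type} [Fintype V] {G : SimpleGraph V}, DegLe G Δ → SecondLe G lam →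
      ∀ k : ℕ, (∀ j < k, ∀ H : SimpleGraph (Fin j), ¬ HasSpectralRadius H lam) →
        ∃ W : Finset V, Determines G lam W ∧ k * W.card ≤ k * C + Fintype.card V := by
  obtain ⟨m, hm, hbroom⟩ := exists_path_length hlam
  refine ⟨(Δ + 1) * (2 * m + 2) + ((Δ + 1) ^ (2 * m + 1) + (Δ + 1) ^ m * (Δ + 1) ^ m),
    fun {V} _ {G} hΔ h2 k hk => ?_⟩
  by_cases hB : HasBroom G m
  · obtain ⟨p, q, hp, hpa, hq, hqa⟩ := hB
    obtain ⟨f, hf, hfA⟩ := hbroom hp hpa hq hqa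
    refine ⟨hull G (insert q ((range (2 * m + 1)).image p)), h2.determines hfA hf
      (subset_hull _) (fun i hi j hij => mem_hull_of_adj hi hij), ?_⟩
    have h1 : (insert q ((range (2 * m + 1)).image p)).card ≤ 2 * m + 2 := by
      refine (Finset.card_insert_le _ _).trans ?_
      have := Finset.card_image_le (s := range (2 * m + 1)) (f := p)
      rw [Finset.card_range] at this
      omega
    have h3 := (card_hull_le hΔ (insert q ((range (2 * m + 1)).image p))).trans
      (Nat.mul_le_mul_left (Δ + 1) h1)
    refine le_trans (Nat.mul_le_mul_left k (h3.trans ?_)) (Nat.le_add_right _ _)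
    exact Nat.le_add_right _ _
  · set C₂ := (Δ + 1) ^ (2 * m + 1) + (Δ + 1) ^ m * (Δ + 1) ^ m with hC₂
    set rep : G.ConnectedComponent → V := Quot.out with hrep
    have hrep' : ∀ c, G.connectedComponentMk (rep c) = c := fun c => Quot.out_eq c
    have hreach : ∀ w, G.Reachable (rep (G.connectedComponentMk w)) w :=
      fun w => SimpleGraph.ConnectedComponent.exact (hrep' _)
    obtain ⟨W₁, hW₁c, hW₁⟩ : ∃ W₁ : Finset V, W₁.card ≤ C₂ ∧ ∀ c : G.ConnectedComponent,
        Exceeds lam c → ∀ y : V → ℝ, adj G *ᵥ y = lam • y → (∀ w ∈ W₁, y w = 0) →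
          ∀ w, G.connectedComponentMk w = c → y w = 0 := by
      by_cases hex : ∃ c : G.ConnectedComponent, Exceeds lam c
      · obtain ⟨c, hc⟩ := hex
        obtain ⟨W, hWc, hW⟩ := exists_determining_of_not_hasBroom hm hΔ hB (rep c)
        refine ⟨W, hWc, fun c' hc' y hy hyW w hw => ?_⟩
        obtain rfl := h2.exceeds_unique hc hc'
        exact hW lam y hy hyW w (hw ▸ hreach w)
      · exact ⟨∅, by simp, fun c hc => absurd ⟨c, hc⟩ hex⟩
    -- The components of spectral radius exactly `lam`: one value each is enough, and each has at
    -- least `k` vertices.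
    set T : Finset G.ConnectedComponent := univ.filter (fun c => ¬ Exceeds lam c ∧
      ∃ y : V → ℝ, adj G *ᵥ y = lam • y ∧ ∃ w, G.connectedComponentMk w = c ∧ y w ≠ 0) with hT
    refine ⟨T.image rep ∪ W₁, ?_, ?_⟩
    · intro y hy hyW
      funext w
      by_cases hw : Exceeds lam (G.connectedComponentMk w)
      · exact hW₁ _ hw y hy (fun x hx => hyW x (Finset.mem_union_right _ hx)) w rfl
      · by_cases hwT : G.connectedComponentMk w ∈ T
        · exact eigenvector_vanishes hlam0 hw hy (hrep' _)
            (hyW _ (Finset.mem_union_left _ (Finset.mem_image_of_mem _ hwT))) (hreach w)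
        · by_contra h0
          exact hwT (Finset.mem_filter.2 ⟨mem_univ _, hw, y, hy, w, rfl, h0⟩)
    · have hfib : ∀ c ∈ T, k ≤ (univ.filter (fun w => G.connectedComponentMk w = c)).card := by
        intro c hcT
        obtain ⟨-, hc, y, hy, w, hw, hyw⟩ := Finset.mem_filter.1 hcT
        by_contra hlt
        rw [← Fintype.card_subtype] at hlt
        exact hk _ (not_le.1 hlt) _ (hasSpectralRadius_comap hc hy hw hyw
          (Fintype.equivFin {w // G.connectedComponentMk w = c}).symm)
      have hT1 : T.card * k ≤ Fintype.card V := by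
        calc T.card * k ≤ ∑ c ∈ T, (univ.filter (fun w => G.connectedComponentMk w = c)).card := by
              rw [← smul_eq_mul]; exact Finset.card_nsmul_le_sum _ _ _ hfib
          _ ≤ ∑ c, (univ.filter (fun w => G.connectedComponentMk w = c)).card :=
              Finset.sum_le_sum_of_subset (Finset.subset_univ _)
          _ = Fintype.card V := by
              rw [← Finset.card_univ,
                Finset.card_eq_sum_card_fiberwise (f := G.connectedComponentMk) (t := univ)]
              intro w _; simp
      have h4 := Finset.card_union_le (T.image rep) W₁
      have h5 := Finset.card_image_le (s := T) (f := rep)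
      have h6 : (T.image rep ∪ W₁).card ≤ T.card + ((Δ + 1) * (2 * m + 2) + C₂) := by omega
      calc _ ≤ k * (T.card + ((Δ + 1) * (2 * m + 2) + C₂)) := Nat.mul_le_mul_left _ h6
        _ ≤ _ := by rw [mul_add, add_comm, mul_comm k T.card]; exact Nat.add_le_add_left hT1 _

/-- The number `√(2 + √5)` is not totally real, hence not an eigenvalue of a graph. -/
theorem determines_empty {V : Type} [Fintype V] (G : SimpleGraph V) :
    Determines G (√(2 + √5)) ∅ := by
  intro y hy _
  by_contra hy0
  have h5 : √5 * √5 = 5 := Real.mul_self_sqrt (by norm_num)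
  have h5' : 2 < √5 := by
    rw [Real.lt_sqrt (by norm_num)]; norm_num
  set μ := √(2 + √5) with hμ
  have hμ2 : μ * μ = 2 + √5 := Real.mul_self_sqrt (by positivity)
  set A := adj G with hA
  set Q : Matrix V V ℚ := G.adjMatrix ℚ with hQ
  have hQA : Q.map (Rat.castHom ℝ) = A := by
    ext i j
    simp [hQ, hA, adj, SimpleGraph.adjMatrix_apply]
    split_ifs <;> simp
  -- The polynomial is `t⁴ - 4t² - 1 = (t² - 2 - √5)(t² - 2 + √5)`. Singularity descends to `ℚ`,
  -- which gives a rational kernel vector `x`.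
  set P : Matrix V V ℚ := Q * Q * (Q * Q) - (4 : ℚ) • (Q * Q) - 1 with hP
  have hPA : P.map (Rat.castHom ℝ) = A * A * (A * A) - (4 : ℝ) • (A * A) - 1 := by
    rw [← hQA, hP]
    ext i j
    simp [Matrix.map_apply, Matrix.mul_apply, Matrix.one_apply]
    split_ifs <;> simp
  have hAAy : (A * A) *ᵥ y = (2 + √5) • y := by
    rw [← Matrix.mulVec_mulVec, hy, Matrix.mulVec_smul, hy, smul_smul, hμ2]
  have hdet : (P.map (Rat.castHom ℝ)).det = 0 := by
    rw [← Matrix.exists_mulVec_eq_zero_iff]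
    refine ⟨y, hy0, ?_⟩
    rw [hPA, Matrix.sub_mulVec, Matrix.sub_mulVec, ← Matrix.mulVec_mulVec, Matrix.smul_mulVec,
      hAAy, Matrix.mulVec_smul, hAAy, Matrix.one_mulVec]
    funext i
    simp only [Pi.sub_apply, Pi.smul_apply, smul_eq_mul, Pi.zero_apply]
    linear_combination y i * h5
  have hdetQ : P.det = 0 := by
    have : (Rat.castHom ℝ) P.det = 0 := by
      rw [RingHom.map_det]; exact hdet
    simpa using this
  obtain ⟨x, hx0, hx⟩ := Matrix.exists_mulVec_eq_zero_iff.2 hdetQ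
  set X : V → ℝ := fun i => (x i : ℝ) with hX
  have cast_mulVec : ∀ (M : Matrix V V ℚ) (i : V),
      (M.map (Rat.castHom ℝ) *ᵥ X) i = ((M *ᵥ x) i : ℚ) := by
    intro M i
    simp [Matrix.mulVec, dotProduct, hX]
  have hPX : (A * A) *ᵥ ((A * A) *ᵥ X) = (4 : ℝ) • ((A * A) *ᵥ X) + X := by
    have : P.map (Rat.castHom ℝ) *ᵥ X = 0 := by
      funext i
      rw [cast_mulVec, hx]; simp
    rw [hPA, Matrix.sub_mulVec, Matrix.sub_mulVec, ← Matrix.mulVec_mulVec, Matrix.smul_mulVec,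
      Matrix.one_mulVec, sub_sub, sub_eq_zero] at this
    exact this
  set B := A * A with hB
  -- `z` satisfies `A² z = (2 - √5) z` with a negative factor, while `A²` is positive semidefinite;
  -- so `z = 0`, and a nonzero entry of `x` makes `√5` rational.
  set z := B *ᵥ X - (2 + √5) • X with hz
  have hBz : B *ᵥ z = (2 - √5) • z := by
    rw [hz, Matrix.mulVec_sub, Matrix.mulVec_smul, hPX]
    funext i
    simp only [Pi.sub_apply, Pi.add_apply, Pi.smul_apply, smul_eq_mul]
    linear_combination -(X i) * h5
  have hz0 : z = 0 := by
    have h1 : z ⬝ᵥ B *ᵥ z = (A *ᵥ z) ⬝ᵥ (A *ᵥ z) := by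
      rw [hB, ← Matrix.mulVec_mulVec, hA, adj_form_comm]
    have h2 : 0 ≤ (A *ᵥ z) ⬝ᵥ (A *ᵥ z) := Finset.sum_nonneg fun i _ => mul_self_nonneg _
    have h3 : 0 ≤ z ⬝ᵥ z := Finset.sum_nonneg fun i _ => mul_self_nonneg _
    rw [← h1, hBz, dotProduct_smul, smul_eq_mul] at h2
    exact dotProduct_self_eq_zero.1 (by nlinarith)
  obtain ⟨i, hi⟩ : ∃ i, x i ≠ 0 := by
    by_contra h
    push Not at h
    exact hx0 (funext h)
  have h6 := congrFun hz0 i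
  rw [hz, Pi.sub_apply, hB, ← hQA, ← Matrix.map_mul, cast_mulVec] at h6
  simp only [Pi.smul_apply, smul_eq_mul, Pi.zero_apply, hX] at h6
  have hi' : (x i : ℝ) ≠ 0 := by exact_mod_cast hi
  have hirr : Irrational √5 := by
    simpa using (show Nat.Prime 5 by norm_num).irrational_sqrt
  apply hirr
  refine ⟨((Q * Q) *ᵥ x) i / x i - 2, ?_⟩
  push_cast
  field_simp
  linarith

end Determining

/-! ### From lines to graphs, and the dimension bound -/

section UpperBound

open scoped Classical Matrix

/-- The angle condition of two lines in terms of unit vectors. -/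
theorem min_angle_eq_arccos_iff {E : Type} [NormedAddCommGroup E] [InnerProductSpace ℝ E]
    {α : ℝ} (hα : 0 < α) (hα1 : α < 1) {u v : E} (hu : ‖u‖ = 1) (hv : ‖v‖ = 1) :
    min (InnerProductGeometry.angle u v) (InnerProductGeometry.angle u (-v)) = Real.arccos α ↔
      |inner ℝ u v| = α := by
  have hle : |inner ℝ u v| ≤ 1 := by
    simpa [hu, hv] using abs_real_inner_le_norm u v
  have e1 : InnerProductGeometry.angle u v = Real.arccos (inner ℝ u v) := by
    simp [InnerProductGeometry.angle, hu, hv]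
  have e2 : InnerProductGeometry.angle u (-v) = Real.arccos (-inner ℝ u v) := by
    simp [InnerProductGeometry.angle, hu, hv]
  have e3 : min (InnerProductGeometry.angle u v) (InnerProductGeometry.angle u (-v)) =
      Real.arccos |inner ℝ u v| := by
    rw [e1, e2, abs, ← Real.antitone_arccos.map_max]
  rw [e3]
  constructor
  · intro h
    exact Real.arccos_injOn ⟨by linarith [abs_nonneg (inner ℝ u v)], hle⟩
      ⟨by linarith, hα1.le⟩ h
  · intro h; rw [h]

theorem exists_unit_vectors {α : ℝ} (hα : 0 < α) (hα1 : α < 1) {n N : ℕ}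
    (h : N ∈ equiangularSizes α n) : ∃ v : Fin N → EuclideanSpace ℝ (Fin n),
      (∀ i, ‖v i‖ = 1) ∧ ∀ i j, i ≠ j → |inner ℝ (v i) (v j)| = α := by
  obtain ⟨S, ⟨h1, h2⟩, hS⟩ := h
  set e := (S.equivFinOfCardEq hS).symm
  have : ∀ i, ∃ v ∈ (e i : Submodule ℝ (EuclideanSpace ℝ (Fin n))), ‖v‖ = 1 := by
    intro i
    have hf := h1 (e i) (e i).2
    have hnt : Nontrivial ((e i : Submodule ℝ (EuclideanSpace ℝ (Fin n)))) :=
      Module.nontrivial_of_finrank_pos (R := ℝ) (by omega)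
    obtain ⟨x, hx⟩ := exists_norm_eq ((e i : Submodule ℝ (EuclideanSpace ℝ (Fin n)))) zero_le_one
    exact ⟨x, x.2, hx⟩
  choose v hv hv1 using this
  refine ⟨v, hv1, fun i j hij => ?_⟩
  have hne : ∀ i, v i ≠ 0 := fun i h => by simpa [h] using hv1 i
  have := h2 (e i) (e i).2 (e j) (e j).2 (fun h => hij (e.injective (Subtype.ext h)))
    (v i) (hv i) (v j) (hv j) (hne i) (hne j)
  exact (min_angle_eq_arccos_iff hα hα1 (hv1 i) (hv1 j)).1 this

theorem mem_equiangularSizes {α : ℝ} (hα : 0 < α) (hα1 : α < 1) {n N : ℕ}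
    (v : Fin N → EuclideanSpace ℝ (Fin n)) (h1 : ∀ i, ‖v i‖ = 1)
    (h2 : ∀ i j, i ≠ j → |inner ℝ (v i) (v j)| = α) : N ∈ equiangularSizes α n := by
  have hne : ∀ i, v i ≠ 0 := fun i h => by simpa [h] using h1 i
  have hinj : Function.Injective (fun i => Submodule.span ℝ {v i}) := by
    intro i j hij
    by_contra hne'
    have hm : v i ∈ Submodule.span ℝ {v j} := by
      rw [← show Submodule.span ℝ {v i} = Submodule.span ℝ {v j} from hij]
      exact Submodule.mem_span_singleton_self _
    obtain ⟨c, hc⟩ := Submodule.mem_span_singleton.1 hm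
    have hc1 : |c| = 1 := by
      have := h1 i
      rwa [← hc, norm_smul, h1 j, mul_one, Real.norm_eq_abs] at this
    have := h2 i j hne'
    rw [← hc, inner_smul_left, real_inner_self_eq_norm_sq, h1 j] at this
    simp [hc1] at this
    linarith
  refine ⟨univ.image (fun i => Submodule.span ℝ {v i}), ⟨?_, ?_⟩, ?_⟩
  · intro l hl
    simp only [coe_image, coe_univ, Set.image_univ, Set.mem_range] at hl
    obtain ⟨i, rfl⟩ := hl
    exact finrank_span_singleton (hne i)
  · intro l₁ hl₁ l₂ hl₂ hne' a ha b hb ha0 hb0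
    simp only [coe_image, coe_univ, Set.image_univ, Set.mem_range] at hl₁ hl₂
    obtain ⟨i, rfl⟩ := hl₁
    obtain ⟨j, rfl⟩ := hl₂
    have hij : i ≠ j := by rintro rfl; exact hne' rfl
    obtain ⟨c, rfl⟩ := Submodule.mem_span_singleton.1 ha
    obtain ⟨d, rfl⟩ := Submodule.mem_span_singleton.1 hb
    have hc : c ≠ 0 := by rintro rfl; simp at ha0
    have hd : d ≠ 0 := by rintro rfl; simp at hb0
    have key := (min_angle_eq_arccos_iff hα hα1 (h1 i) (h1 j)).2 (h2 i j hij)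
    have flip : InnerProductGeometry.angle (-v i) (v j) =
        InnerProductGeometry.angle (v i) (-v j) := by
      rw [← InnerProductGeometry.angle_neg_neg, neg_neg]
    rw [← smul_neg]
    rcases lt_or_gt_of_ne hc with hc | hc <;> rcases lt_or_gt_of_ne hd with hd | hd
    · rw [InnerProductGeometry.angle_smul_left_of_neg _ _ hc,
        InnerProductGeometry.angle_smul_left_of_neg _ _ hc,
        InnerProductGeometry.angle_smul_right_of_neg _ _ hd,
        InnerProductGeometry.angle_smul_right_of_neg _ _ hd, neg_neg,
        InnerProductGeometry.angle_neg_neg, flip]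
      exact key
    · rw [InnerProductGeometry.angle_smul_left_of_neg _ _ hc,
        InnerProductGeometry.angle_smul_left_of_neg _ _ hc,
        InnerProductGeometry.angle_smul_right_of_pos _ _ hd,
        InnerProductGeometry.angle_smul_right_of_pos _ _ hd,
        InnerProductGeometry.angle_neg_neg, flip, min_comm]
      exact key
    · rw [InnerProductGeometry.angle_smul_left_of_pos _ _ hc,
        InnerProductGeometry.angle_smul_left_of_pos _ _ hc,
        InnerProductGeometry.angle_smul_right_of_neg _ _ hd,
        InnerProductGeometry.angle_smul_right_of_neg _ _ hd, neg_neg, min_comm]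
      exact key
    · rw [InnerProductGeometry.angle_smul_left_of_pos _ _ hc,
        InnerProductGeometry.angle_smul_left_of_pos _ _ hc,
        InnerProductGeometry.angle_smul_right_of_pos _ _ hd,
        InnerProductGeometry.angle_smul_right_of_pos _ _ hd]
      exact key
  · rw [Finset.card_image_of_injective _ hinj, Finset.card_univ, Fintype.card_fin]

/-- The graph of the pairs with inner product `-α`. -/
def negGraph {V E : Type} [NormedAddCommGroup E] [InnerProductSpace ℝ E] (α : ℝ) (v : V → E) :
    SimpleGraph V where
  Adj i j := i ≠ j ∧ inner ℝ (v i) (v j) = -α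
  symm := ⟨fun i j h => ⟨h.1.symm, by rw [real_inner_comm]; exact h.2⟩⟩
  loopless := ⟨fun i h => h.1 rfl⟩

variable {V E : Type} [NormedAddCommGroup E] [InnerProductSpace ℝ E] [Fintype V]

/-- This is the identity `(1-α) I + α J - 2α A` for the Gram matrix, applied to `x`. -/
theorem inner_sum_smul {α : ℝ} {v : V → E} (h1 : ∀ i, ‖v i‖ = 1)
    (h2 : ∀ i j, i ≠ j → |inner ℝ (v i) (v j)| = α) (x : V → ℝ) (i : V) :
    inner ℝ (v i) (∑ j, x j • v j) =
      (1 - α) * x i + α * ∑ j, x j - 2 * α * (adj (negGraph α v) *ᵥ x) i := by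
  rw [adj_mulVec, inner_sum, Finset.sum_filter]
  have : ∀ j, inner ℝ (v i) (x j • v j) = (if i = j then (1 - α) * x j else 0) + α * x j
      - 2 * α * (if (negGraph α v).Adj i j then x j else 0) := by
    intro j
    rw [inner_smul_right]
    by_cases hij : i = j
    · subst hij
      rw [if_pos rfl, if_neg (SimpleGraph.irrefl _), real_inner_self_eq_norm_sq, h1]
      ring
    · rw [if_neg hij]
      by_cases hadj : (negGraph α v).Adj i j
      · rw [if_pos hadj, hadj.2]; ring
      · rw [if_neg hadj]
        rcases eq_or_eq_neg_of_abs_eq (h2 i j hij) with h | h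
        · rw [h]; ring
        · exact absurd ⟨hij, h⟩ hadj
  rw [Finset.sum_congr rfl (fun j _ => this j), Finset.sum_sub_distrib, Finset.sum_add_distrib,
    Finset.sum_ite_eq, if_pos (Finset.mem_univ i), ← Finset.mul_sum, ← Finset.mul_sum]

theorem secondLe_negGraph {α : ℝ} (hα : 0 < α) {v : V → E} (h1 : ∀ i, ‖v i‖ = 1)
    (h2 : ∀ i j, i ≠ j → |inner ℝ (v i) (v j)| = α) :
    SecondLe (negGraph α v) ((1 - α) / (2 * α)) := by
  intro x hx
  have h3 : inner ℝ (∑ i, x i • v i) (∑ j, x j • v j) =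
      (1 - α) * (x ⬝ᵥ x) - 2 * α * (x ⬝ᵥ adj (negGraph α v) *ᵥ x) := by
    rw [sum_inner]
    simp only [inner_smul_left, inner_sum_smul h1 h2, hx, dotProduct, Finset.mul_sum,
      ← Finset.sum_sub_distrib]
    refine Finset.sum_congr rfl fun i _ => ?_
    simp; ring
  have h4 : 0 ≤ inner ℝ (∑ i, x i • v i) (∑ j, x j • v j) := real_inner_self_nonneg
  rw [h3] at h4
  rw [div_mul_eq_mul_div, le_div_iff₀ (by positivity)]
  linarith

/-- The number of vectors is bounded by the dimension and the number of values that determine the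
eigenvectors of the graph. -/
theorem card_le_of_determines [FiniteDimensional ℝ E] {α : ℝ} (hα : 0 < α) {v : V → E}
    (h1 : ∀ i, ‖v i‖ = 1) (h2 : ∀ i j, i ≠ j → |inner ℝ (v i) (v j)| = α) {W : Finset V}
    (hW : Determines (negGraph α v) ((1 - α) / (2 * α)) W) :
    Fintype.card V ≤ Module.finrank ℝ E + (1 + W.card) := by
  -- In the kernel of the first two components the Gram identity becomes `A x = λ x`; the third one
  -- then forces `x = 0`.
  set Φ : (V → ℝ) →ₗ[ℝ] E × ℝ × (W → ℝ) :=
    (Fintype.linearCombination ℝ v).prod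
      ((Fintype.linearCombination ℝ (fun _ : V => (1 : ℝ))).prod
        (LinearMap.funLeft ℝ ℝ (fun w : W => (w : V)))) with hΦ
  have hinj : Function.Injective Φ := by
    rw [injective_iff_map_eq_zero]
    intro x hx
    have hx1 : ∑ i, x i • v i = 0 := by
      simpa [hΦ, Fintype.linearCombination_apply] using congrArg Prod.fst hx
    have hx2 : ∑ i, x i = 0 := by
      simpa [hΦ, Fintype.linearCombination_apply] using congrArg (fun p => p.2.1) hx
    have hx3 : ∀ w : W, x w = 0 := fun w => congrFun (congrArg (fun p => p.2.2) hx) w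
    refine hW x (funext fun i => ?_) (fun w hw => hx3 ⟨w, hw⟩)
    have := inner_sum_smul h1 h2 x i
    rw [hx1, hx2, inner_zero_right] at this
    rw [Pi.smul_apply, smul_eq_mul]
    field_simp
    linarith
  have := LinearMap.finrank_le_finrank_of_injective hinj
  simpa using this

end UpperBound

/-! ### The upper bound -/

section UpperBoundSizes

open scoped Classical Matrix

/-- Letting `k` be any lower bound for the spectral radius order, with `C` independent of `k`,
covers finite and infinite order at once. -/
theorem exists_upper_bound {α : ℝ} (hα : 0 < α) (hα1 : α < 1)
    (hlam : (1 - α) / (2 * α) ≤ √(2 + √5)) : ∃ C : ℕ, ∀ n N : ℕ, N ∈ equiangularSizes α n →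
      ∀ k : ℕ, (∀ j < k, ∀ H : SimpleGraph (Fin j), ¬ HasSpectralRadius H ((1 - α) / (2 * α))) →
        k * N ≤ k * (n + C) + N := by
  have hlam0 : 0 < (1 - α) / (2 * α) := div_pos (by linarith) (by linarith)
  rcases hlam.lt_or_eq with hlt | heq
  · obtain ⟨Δ, hΔ⟩ := exists_switching hα hα1
    obtain ⟨C, hC⟩ := exists_determining hlam0 hlt Δ
    refine ⟨1 + C, fun n N hN k hk => ?_⟩
    obtain ⟨v, hv1, hv2⟩ := exists_unit_vectors hα hα1 hN
    obtain ⟨w, hw, hwΔ⟩ := hΔ v hv1 hv2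
    have hw1 : ∀ i, ‖w i‖ = 1 := by
      intro i; rcases hw i with h | h <;> rw [h] <;> simp [hv1]
    have hw2 : ∀ i j, i ≠ j → |inner ℝ (w i) (w j)| = α := by
      intro i j hij
      rcases hw i with h | h <;> rcases hw j with h' | h' <;> rw [h, h'] <;> simp [hv2 i j hij]
    have hdeg : DegLe (negGraph α w) Δ := fun i => hwΔ i _ (fun j hj => by
      have := (Finset.mem_filter.1 hj).2
      exact ⟨this.1.symm, this.2⟩)
    obtain ⟨W, hW, hWk⟩ := hC hdeg (secondLe_negGraph hα hw1 hw2) k hk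
    have := card_le_of_determines hα hw1 hw2 hW
    rw [Fintype.card_fin, finrank_euclideanSpace_fin] at this
    rw [Fintype.card_fin] at hWk
    calc k * N ≤ k * (n + (1 + W.card)) := Nat.mul_le_mul_left _ this
      _ = k * n + k + k * W.card := by ring
      _ ≤ k * n + k + (k * C + N) := Nat.add_le_add_left hWk _
      _ = _ := by ring
  · refine ⟨1, fun n N hN k _ => ?_⟩
    obtain ⟨v, hv1, hv2⟩ := exists_unit_vectors hα hα1 hN
    have := card_le_of_determines hα hv1 hv2 (W := ∅) (by rw [heq]; exact determines_empty _)
    rw [Fintype.card_fin, finrank_euclideanSpace_fin] at this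
    exact (Nat.mul_le_mul_left k this).trans (Nat.le_add_right _ _)

end UpperBoundSizes

/-! ### Constructions of equiangular lines -/

section LowerBound

open scoped Classical Matrix

theorem exists_linearIsometry {E : Type} [NormedAddCommGroup E] [InnerProductSpace ℝ E]
    [FiniteDimensional ℝ E] {n : ℕ} (h : Module.finrank ℝ E ≤ n) :
    Nonempty (E →ₗᵢ[ℝ] EuclideanSpace ℝ (Fin n)) := by
  set b := stdOrthonormalBasis ℝ E
  set c := EuclideanSpace.basisFun (Fin n) ℝ
  refine ⟨(b.toBasis.constr ℝ (fun i => c (Fin.castLE h i))).isometryOfOrthonormal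
    (v := b.toBasis) (by simp) ?_⟩
  have : (b.toBasis.constr ℝ (fun i => c (Fin.castLE h i))) ∘ b.toBasis =
      c ∘ Fin.castLE h := by
    funext i
    simp
  rw [this]
  exact c.orthonormal.comp _ (Fin.castLE_injective h)

/-- A singular positive semidefinite matrix of order `k` is a Gram matrix of vectors
in a space of dimension `k - 1`. -/
theorem exists_gram {k : ℕ} {M : Matrix (Fin k) (Fin k) ℝ} (hM : M.PosSemidef) {x : Fin k → ℝ}
    (hx0 : x ≠ 0) (hx : M *ᵥ x = 0) :
    ∃ u : Fin k → EuclideanSpace ℝ (Fin (k - 1)), ∀ i j, inner ℝ (u i) (u j) = M i j := by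
  obtain ⟨m, B, hB⟩ := Matrix.posSemidef_iff_eq_sum_vecMulVec.1 hM
  set a : Fin k → EuclideanSpace ℝ (Fin m) := fun i => WithLp.toLp 2 (fun l => B l i) with ha
  have hinner : ∀ i j, inner ℝ (a i) (a j) = M i j := by
    intro i j
    rw [hB, Matrix.sum_apply]
    simp [ha, PiLp.inner_apply, Matrix.vecMulVec_apply, mul_comm]
  -- The kernel vector is a linear relation among the `a i`, so their span has dimension at most `k
  -- - 1`.
  have hsum : ∑ i, x i • a i = 0 := by
    rw [← inner_self_eq_zero (𝕜 := ℝ), sum_inner]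
    refine Finset.sum_eq_zero fun i _ => ?_
    rw [inner_smul_left, inner_sum]
    have := congrFun hx i
    simp only [Matrix.mulVec, dotProduct, Pi.zero_apply] at this
    simp only [inner_smul_right, hinner]
    rw [Finset.sum_congr rfl (fun j _ => mul_comm (x j) (M i j)), this, mul_zero]
  set S := Submodule.span ℝ (Set.range a) with hS
  have hfin : Module.finrank ℝ S ≤ k - 1 := by
    have h1 : (Set.range a).finrank ℝ ≤ k := by simpa using finrank_range_le_card (R := ℝ) a
    have h2 : (Set.range a).finrank ℝ ≠ k := by
      intro h
      have hli : LinearIndependent ℝ a :=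
        linearIndependent_iff_card_eq_finrank_span.2 (by simpa using h.symm)
      exact hx0 (funext fun i => Fintype.linearIndependent_iff.1 hli x hsum i)
    change (Set.range a).finrank ℝ ≤ k - 1
    omega
  obtain ⟨φ⟩ := exists_linearIsometry hfin
  refine ⟨fun i => φ ⟨a i, Submodule.subset_span ⟨i, rfl⟩⟩, fun i j => ?_⟩
  rw [φ.inner_map_map, Submodule.coe_inner, hinner]

/-- Disjoint copies of a graph, realised by equiangular lines. -/
theorem mul_mem_equiangularSizes {α : ℝ} (hα : 0 < α) (hα1 : α < 1) {k d : ℕ}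
    {H : SimpleGraph (Fin k)} {u : Fin k → EuclideanSpace ℝ (Fin d)}
    (hu : ∀ i j, inner ℝ (u i) (u j) =
      (if i = j then 1 - α else 0) - 2 * α * (if H.Adj i j then 1 else 0))
    {t n : ℕ} (htn : t * d + 1 ≤ n) : t * k ∈ equiangularSizes α n := by
  -- Copies occupy orthogonal blocks; the common coordinate `√α` adds `α` to every inner product,
  -- turning `0` and `-2α` into `α` and `-α`.
  set w : Fin t × Fin k → EuclideanSpace ℝ (Option (Fin t × Fin d)) := fun p =>
    WithLp.toLp 2 (fun o => o.elim √α (fun q => if p.1 = q.1 then u p.2 q.2 else 0)) with hw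
  have hin : ∀ p q, inner ℝ (w p) (w q) = α + if p.1 = q.1 then inner ℝ (u p.2) (u q.2) else 0 := by
    intro p q
    simp only [hw, PiLp.inner_apply, Fintype.sum_option, Option.elim_none, Option.elim_some,
      Fintype.sum_prod_type]
    congr 1
    · simp [hα.le]
    · by_cases hpq : p.1 = q.1
      · rw [if_pos hpq, Finset.sum_eq_single p.1]
        · simp [hpq]
        · intro b _ hb
          simp [hb.symm]
        · simp
      · rw [if_neg hpq]
        refine Finset.sum_eq_zero fun b _ => Finset.sum_eq_zero fun c _ => ?_
        by_cases h : p.1 = b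
        · have : q.1 ≠ b := fun h' => hpq (h.trans h'.symm)
          simp [this]
        · simp [h]
  have hfr : Module.finrank ℝ (EuclideanSpace ℝ (Option (Fin t × Fin d))) ≤ n := by
    simpa using htn
  obtain ⟨φ⟩ := exists_linearIsometry hfr
  refine mem_equiangularSizes hα hα1 (fun i => φ (w (finProdFinEquiv.symm i))) ?_ ?_
  · intro i
    rw [φ.norm_map]
    have := hin (finProdFinEquiv.symm i) (finProdFinEquiv.symm i)
    rw [if_pos rfl, hu, if_pos rfl, if_neg (SimpleGraph.irrefl _),
      real_inner_self_eq_norm_sq] at this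
    have h2 : ‖w (finProdFinEquiv.symm i)‖ ^ 2 = 1 := by rw [this]; ring
    exact (pow_eq_one_iff_of_nonneg (norm_nonneg _) two_ne_zero).1 h2
  · intro i j hij
    rw [φ.inner_map_map, hin]
    set p := finProdFinEquiv.symm i with hp
    set q := finProdFinEquiv.symm j with hq
    have hpq : p ≠ q := fun h => hij (finProdFinEquiv.symm.injective h)
    split_ifs with h1
    · have h2 : p.2 ≠ q.2 := fun h => hpq (Prod.ext h1 h)
      rw [hu, if_neg h2]
      split_ifs
      · rw [show α + (0 - 2 * α * 1) = -α by ring, abs_neg, abs_of_pos hα]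
      · simp [abs_of_pos hα]
    · rw [add_zero, abs_of_pos hα]

/-- `(1-α) I - 2α A` is positive semidefinite because `λ` is the largest eigenvalue, and singular
because it is an eigenvalue. -/
theorem mul_mem_of_hasSpectralRadius {α : ℝ} (hα : 0 < α) (hα1 : α < 1) {k : ℕ}
    {H : SimpleGraph (Fin k)} (hH : HasSpectralRadius H ((1 - α) / (2 * α))) {t n : ℕ}
    (htn : t * (k - 1) + 1 ≤ n) : t * k ∈ equiangularSizes α n := by
  obtain ⟨⟨x, hx0, hx⟩, hmax⟩ := hasSpectralRadius_iff.1 hH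
  set lam := (1 - α) / (2 * α) with hlam
  have h2 : 2 * α * lam = 1 - α := by rw [hlam]; field_simp
  set M : Matrix (Fin k) (Fin k) ℝ := (1 - α) • (1 : Matrix (Fin k) (Fin k) ℝ) - (2 * α) • adj H
    with hM
  have hMv : ∀ y, M *ᵥ y = (1 - α) • y - (2 * α) • (adj H *ᵥ y) := by
    intro y
    rw [hM, Matrix.sub_mulVec, Matrix.smul_mulVec, Matrix.smul_mulVec, Matrix.one_mulVec]
  have hherm : M.IsHermitian := by
    have : (adj H)ᵀ = adj H := by simp [adj]
    rw [Matrix.IsHermitian, Matrix.conjTranspose_eq_transpose_of_trivial, hM,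
      Matrix.transpose_sub, Matrix.transpose_smul, Matrix.transpose_smul, this,
      Matrix.transpose_one]
  have hpsd : M.PosSemidef := by
    rw [hherm.posSemidef_iff_eigenvalues_nonneg]
    intro i
    have h3 := hherm.mulVec_eigenvectorBasis i
    set y : Fin k → ℝ := (hherm.eigenvectorBasis i).ofLp with hy
    have hy0 : y ≠ 0 := by
      intro h
      have h4 := hherm.eigenvectorBasis.orthonormal.1 i
      have h5 : hherm.eigenvectorBasis i = 0 := by
        ext j; exact congrFun h j
      rw [h5] at h4; simp at h4
    rw [hMv] at h3
    have h6 : adj H *ᵥ y = ((1 - α - hherm.eigenvalues i) / (2 * α)) • y := by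
      funext j
      have := congrFun h3 j
      simp only [Pi.sub_apply, Pi.smul_apply, smul_eq_mul] at this ⊢
      field_simp
      linarith
    have h7 := hmax _ y hy0 h6
    rw [hlam, div_le_div_iff_of_pos_right (by positivity)] at h7
    simp only [Pi.zero_apply]
    linarith
  obtain ⟨u, hu⟩ := exists_gram hpsd hx0 (by
    rw [hMv, hx, smul_smul, h2, sub_self])
  refine mul_mem_equiangularSizes hα hα1 (H := H) (u := u) (fun i j => ?_) htn
  rw [hu, hM, adj]
  simp [Matrix.one_apply, SimpleGraph.adjMatrix_apply]

/-- The construction with the one-vertex graph: all inner products equal `α`, and no spectral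
condition is needed. -/
theorem pred_mem_equiangularSizes {α : ℝ} (hα : 0 < α) (hα1 : α < 1) {n : ℕ} (hn : 1 ≤ n) :
    n - 1 ∈ equiangularSizes α n := by
  have := mul_mem_equiangularSizes hα hα1 (k := 1) (d := 1) (H := ⊥) (t := n - 1) (n := n)
    (u := fun _ => EuclideanSpace.single 0 √(1 - α)) (fun i j => by
      have : 0 ≤ 1 - α := by linarith
      simp [Subsingleton.elim i j, this, Real.sq_sqrt]) (by omega)
  simpa using this

theorem zero_mem_equiangularSizes {α : ℝ} (hα : 0 < α) (hα1 : α < 1) (n : ℕ) :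
    0 ∈ equiangularSizes α n :=
  mem_equiangularSizes hα hα1 (fun i => i.elim0) (fun i => i.elim0) (fun i => i.elim0)

end LowerBound

/-! ### The spectral radius order and small graphs -/

section Order

open scoped Classical Matrix

/-- At an entry of largest absolute value the eigenvalue is bounded by the degree. -/
theorem eigenvalue_add_one_le {V : Type} [Fintype V] {G : SimpleGraph V} {μ : ℝ} {x : V → ℝ}
    (hx0 : x ≠ 0) (hx : adj G *ᵥ x = μ • x) : μ + 1 ≤ Fintype.card V := by
  obtain ⟨i₀, hi₀⟩ : ∃ i, x i ≠ 0 := by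
    by_contra h
    push Not at h
    exact hx0 (funext h)
  obtain ⟨i, -, hi⟩ := Finset.exists_max_image univ (fun i => |x i|) ⟨i₀, mem_univ _⟩
  have hpos : 0 < |x i| := (abs_pos.2 hi₀).trans_le (hi i₀ (mem_univ _))
  have h1 := congrFun hx i
  rw [adj_mulVec, Pi.smul_apply, smul_eq_mul] at h1
  have h2 : |μ| * |x i| ≤ (univ.filter (G.Adj i)).card * |x i| := by
    rw [← abs_mul, ← h1, ← nsmul_eq_mul]
    exact (Finset.abs_sum_le_sum_abs _ _).trans
      (Finset.sum_le_card_nsmul _ _ _ (fun j _ => hi j (mem_univ _)))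
  have h3 : (univ.filter (G.Adj i)).card + 1 ≤ Fintype.card V := by
    rw [← Finset.card_univ, ← Finset.card_insert_of_notMem (a := i)
      (s := univ.filter (G.Adj i)) (by simp)]
    exact Finset.card_le_card (Finset.subset_univ _)
  have h4 := le_of_mul_le_mul_right h2 hpos
  have h5 : ((univ.filter (G.Adj i)).card : ℝ) + 1 ≤ Fintype.card V := by exact_mod_cast h3
  linarith [le_abs_self μ]

theorem HasSpectralRadius.add_one_le {j : ℕ} {H : SimpleGraph (Fin j)} {μ : ℝ}
    (h : HasSpectralRadius H μ) : μ + 1 ≤ j := by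
  obtain ⟨⟨x, hx0, hx⟩, -⟩ := hasSpectralRadius_iff.1 h
  simpa using eigenvalue_add_one_le hx0 hx

theorem exists_of_spectralRadiusOrder_eq {μ : ℝ} {k : ℕ} (h : spectralRadiusOrder μ = k) :
    (∃ H : SimpleGraph (Fin k), HasSpectralRadius H μ) ∧
      ∀ j < k, ∀ H : SimpleGraph (Fin j), ¬ HasSpectralRadius H μ := by
  constructor
  · have hne : {k : ℕ∞ | ∃ m : ℕ, k = (m : ℕ∞) ∧
        ∃ G : SimpleGraph (Fin m), HasSpectralRadius G μ}.Nonempty := by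
      by_contra hcon
      rw [Set.not_nonempty_iff_eq_empty] at hcon
      rw [spectralRadiusOrder, hcon, sInf_empty] at h
      exact absurd h.symm (ENat.natCast_ne_top k)
    obtain ⟨m, hm, G, hG⟩ := csInf_mem hne
    change spectralRadiusOrder μ = m at hm
    rw [h] at hm
    obtain rfl : k = m := by exact_mod_cast hm
    exact ⟨G, hG⟩
  · intro j hj H hH
    have : spectralRadiusOrder μ ≤ j := sInf_le ⟨j, rfl, H, hH⟩
    rw [h] at this
    have : k ≤ j := by exact_mod_cast this
    omega

theorem not_hasSpectralRadius_of_order_eq_top {μ : ℝ} (h : spectralRadiusOrder μ = ⊤) (j : ℕ)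
    (H : SimpleGraph (Fin j)) : ¬ HasSpectralRadius H μ := by
  intro hH
  have : spectralRadiusOrder μ ≤ j := sInf_le ⟨j, rfl, H, hH⟩
  rw [h, top_le_iff] at this
  exact ENat.natCast_ne_top j this

/-- Every graph with spectral radius `μ` has at least `μ + 1` vertices, so one with fewer than `μ +
2` is smallest. -/
theorem spectralRadiusOrder_eq {μ : ℝ} {k : ℕ} {H : SimpleGraph (Fin k)}
    (hH : HasSpectralRadius H μ) (hk : (k : ℝ) < μ + 2) : spectralRadiusOrder μ = k := by
  refine le_antisymm (sInf_le ⟨k, rfl, H, hH⟩) (le_sInf ?_)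
  rintro _ ⟨m, rfl, G, hG⟩
  have h1 := hG.add_one_le
  have : (k : ℝ) < (m : ℝ) + 1 := by linarith
  have : k < m + 1 := by exact_mod_cast this
  exact_mod_cast Nat.lt_succ_iff.1 this

theorem hasSpectralRadius_top {k : ℕ} (hk : 1 ≤ k) :
    HasSpectralRadius (⊤ : SimpleGraph (Fin k)) ((k : ℝ) - 1) := by
  rw [hasSpectralRadius_iff]
  refine ⟨⟨fun _ => 1, ?_, ?_⟩, fun ν x hx0 hx => ?_⟩
  · intro h
    have := congrFun h ⟨0, hk⟩
    norm_num at this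
  · funext i
    rw [adj_mulVec]
    rw [Finset.sum_const, nsmul_eq_mul]
    convert_to ((univ.erase i).card : ℝ) * 1 = _
    · congr 3; ext j; simp [eq_comm]
    · simp [Nat.cast_sub hk]
  · have := eigenvalue_add_one_le hx0 hx
    rw [Fintype.card_fin] at this
    linarith

/-- The path with three vertices. -/
def cherry : SimpleGraph (Fin 3) where
  Adj i j := (i = 1 ∧ j ≠ 1) ∨ (i ≠ 1 ∧ j = 1)
  symm := ⟨fun i j h => by tauto⟩
  loopless := ⟨fun i h => by tauto⟩

theorem hasSpectralRadius_cherry : HasSpectralRadius cherry √2 := by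
  have h2 : √2 * √2 = 2 := Real.mul_self_sqrt (by norm_num)
  have hs : 0 < √2 := by positivity
  have e0 : ∀ x : Fin 3 → ℝ, (adj cherry *ᵥ x) 0 = x 1 := by
    intro x; rw [adj_mulVec, Finset.sum_filter, Fin.sum_univ_three]; simp [cherry]
  have e1 : ∀ x : Fin 3 → ℝ, (adj cherry *ᵥ x) 1 = x 0 + x 2 := by
    intro x; rw [adj_mulVec, Finset.sum_filter, Fin.sum_univ_three]; simp [cherry]
  have e2 : ∀ x : Fin 3 → ℝ, (adj cherry *ᵥ x) 2 = x 1 := by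
    intro x; rw [adj_mulVec, Finset.sum_filter, Fin.sum_univ_three]; simp [cherry]
  rw [hasSpectralRadius_iff]
  refine ⟨⟨![1, √2, 1], ?_, ?_⟩, fun ν x hx0 hx => ?_⟩
  · intro h
    have := congrFun h 0
    norm_num at this
  · funext i
    fin_cases i
    · simpa using e0 ![1, √2, 1]
    · have := e1 ![1, √2, 1]
      simp at this
      simp [this, h2]
      norm_num
    · simpa using e2 ![1, √2, 1]
  · by_contra hlt
    rw [not_le] at hlt
    have f0 : x 1 = ν * x 0 := by rw [← e0 x, hx]; rfl
    have f1 : x 0 + x 2 = ν * x 1 := by rw [← e1 x, hx]; rfl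
    have f2 : x 1 = ν * x 2 := by rw [← e2 x, hx]; rfl
    have hν : 0 < ν := hs.trans hlt
    have hν2 : 2 < ν * ν := by nlinarith
    have g1 : (ν * ν - 2) * x 1 = 0 := by linear_combination -ν * f1 - f0 - f2
    have x1 : x 1 = 0 := (mul_eq_zero.1 g1).resolve_left (by linarith)
    have x0 : x 0 = 0 := by
      rw [x1] at f0; exact (mul_eq_zero.1 f0.symm).resolve_left hν.ne'
    have x2 : x 2 = 0 := by
      rw [x1] at f2; exact (mul_eq_zero.1 f2.symm).resolve_left hν.ne'
    apply hx0
    funext i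
    fin_cases i
    · exact x0
    · exact x1
    · exact x2

end Order

/-! ### Asymptotics and special angles -/

section Asymptotics

theorem isGreatest_maxEquiangular {α : ℝ} (hα : 0 < α) (hα1 : α < 1)
    (hlam : (1 - α) / (2 * α) ≤ √(2 + √5)) (n : ℕ) :
    IsGreatest (equiangularSizes α n) (maxEquiangular α n) := by
  have hlam0 : 0 < (1 - α) / (2 * α) := div_pos (by linarith) (by linarith)
  obtain ⟨C, hC⟩ := exists_upper_bound hα hα1 hlam
  have hb : BddAbove (equiangularSizes α n) := by
    refine ⟨2 * (n + C), fun N hN => ?_⟩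
    -- The choice `k = 2` is always allowed: a graph on at most one vertex has no positive
    -- eigenvalue.
    have := hC n N hN 2 (fun j hj H hH => by
      have h1 := hH.add_one_le
      have : (j : ℝ) ≤ 1 := by exact_mod_cast (by omega : j ≤ 1)
      linarith)
    omega
  exact ⟨Nat.sSup_mem ⟨0, zero_mem_equiangularSizes hα hα1 n⟩ hb, fun N hN => le_csSup hb hN⟩

theorem two_le_order {α : ℝ} (hα : 0 < α) (hα1 : α < 1) {k : ℕ}
    (hk : spectralRadiusOrder ((1 - α) / (2 * α)) = (k : ℕ∞)) : 2 ≤ k := by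
  have hlam0 : 0 < (1 - α) / (2 * α) := div_pos (by linarith) (by linarith)
  obtain ⟨⟨H, hH⟩, -⟩ := exists_of_spectralRadiusOrder_eq hk
  have h1 := hH.add_one_le
  have : (1 : ℝ) < k := by linarith
  exact_mod_cast this

theorem asymp_of_order_eq {α : ℝ} (hα : 0 < α) (hα1 : α < 1)
    (hlam : (1 - α) / (2 * α) ≤ √(2 + √5)) {k : ℕ}
    (hk : spectralRadiusOrder ((1 - α) / (2 * α)) = (k : ℕ∞)) :
    MaxEquiangularAsymp α ((k : ℝ) / ((k : ℝ) - 1)) := by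
  have hk2 := two_le_order hα hα1 hk
  obtain ⟨⟨H, hH⟩, hmin⟩ := exists_of_spectralRadiusOrder_eq hk
  obtain ⟨C, hC⟩ := exists_upper_bound hα hα1 hlam
  obtain ⟨d, rfl⟩ : ∃ d, k = d + 1 := ⟨k - 1, by omega⟩
  have hd : 1 ≤ d := by omega
  refine ⟨(d + 1) * C + (d + 1), fun n => ?_⟩
  obtain ⟨hmem, hub⟩ := isGreatest_maxEquiangular hα hα1 hlam n
  set N := maxEquiangular α n
  have hd' : (1 : ℝ) ≤ d := by exact_mod_cast hd
  have hd0 : (0 : ℝ) < d := by linarith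
  have hupper : (d : ℝ) * N ≤ (d + 1) * (n + C) := by
    have := hC n N hmem (d + 1) hmin
    have h : ((d : ℝ) + 1) * N ≤ (d + 1) * (n + C) + N := by exact_mod_cast this
    linarith
  have hlower : ((d : ℝ) + 1) * n ≤ d * N + (d + 1) * d := by
    rcases Nat.eq_zero_or_pos n with rfl | hn
    · push_cast; nlinarith [mul_nonneg hd0.le (Nat.cast_nonneg (α := ℝ) N)]
    -- The number of copies that fit is `⌊(n-1)/d⌋`, one dimension being reserved for the common
    -- coordinate.
    · have h1 : (n - 1) / d * (d + 1) ≤ N := hub (mul_mem_of_hasSpectralRadius hα hα1 hH (by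
        rw [Nat.add_sub_cancel]
        have := Nat.div_mul_le_self (n - 1) d
        omega))
      have h2 : n ≤ d * ((n - 1) / d) + d := by
        have := Nat.div_add_mod (n - 1) d
        have := Nat.mod_lt (n - 1) hd
        omega
      have h1' : (((n - 1) / d : ℕ) : ℝ) * (d + 1) ≤ N := by exact_mod_cast h1
      have h2' : (n : ℝ) ≤ d * (((n - 1) / d : ℕ) : ℝ) + d := by exact_mod_cast h2
      nlinarith [mul_le_mul_of_nonneg_left h1' hd0.le,
        mul_le_mul_of_nonneg_left h2' (by linarith : (0 : ℝ) ≤ d + 1)]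
  have hkd : (((d + 1 : ℕ) : ℝ) / (((d + 1 : ℕ) : ℝ) - 1)) * n = (d + 1) * n / d := by
    push_cast
    rw [add_sub_cancel_right]
    ring
  have hC0 : (0 : ℝ) ≤ C := Nat.cast_nonneg C
  rw [hkd, abs_le]
  constructor
  · have : ((d : ℝ) + 1) * n / d ≤ N + (d + 1) := by
      rw [div_le_iff₀ hd0]; linarith
    nlinarith
  · have : (N : ℝ) - C * (d + 1) ≤ ((d : ℝ) + 1) * n / d := by
      rw [le_div_iff₀ hd0]
      nlinarith [mul_nonneg hC0 (by linarith : (0 : ℝ) ≤ d + 1)]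
    linarith

theorem asymp_of_order_eq_top {α : ℝ} (hα : 0 < α) (hα1 : α < 1)
    (hlam : (1 - α) / (2 * α) ≤ √(2 + √5))
    (hk : spectralRadiusOrder ((1 - α) / (2 * α)) = ⊤) : MaxEquiangularAsymp α 1 := by
  obtain ⟨C, hC⟩ := exists_upper_bound hα hα1 hlam
  refine ⟨C + 1, fun n => ?_⟩
  obtain ⟨hmem, hub⟩ := isGreatest_maxEquiangular hα hα1 hlam n
  set N := maxEquiangular α n
  have hupper : N ≤ n + C := by
    -- With `k = N + 1` the excess `N / k` is below one and disappears in integers.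
    have := hC n N hmem (N + 1) (fun j _ H => not_hasSpectralRadius_of_order_eq_top hk j H)
    by_contra h
    have h2 : (N + 1) * (n + C + 1) ≤ (N + 1) * N := Nat.mul_le_mul_left _ (by omega)
    rw [Nat.mul_add (N + 1) (n + C) 1] at h2
    omega
  have hlower : n ≤ N + 1 := by
    rcases Nat.eq_zero_or_pos n with rfl | hn
    · omega
    · have := hub (pred_mem_equiangularSizes hα hα1 hn)
      omega
  have h1 : (N : ℝ) ≤ n + C := by exact_mod_cast hupper
  have h2 : (n : ℝ) ≤ N + 1 := by exact_mod_cast hlower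
  have hC0 : (0 : ℝ) ≤ C := Nat.cast_nonneg C
  rw [one_mul, abs_le]
  constructor <;> linarith

end Asymptotics

end Equiangular

theorem mainTheorem2 :
    (∀ α : ℝ, 0 < α → α < 1 → (1 - α) / (2 * α) ≤ √(2 + √5) →
      (∀ n : ℕ, IsGreatest (Equiangular.equiangularSizes α n) (Equiangular.maxEquiangular α n)) ∧
      (∀ k : ℕ, Equiangular.spectralRadiusOrder ((1 - α) / (2 * α)) = (k : ℕ∞) →
        2 ≤ k ∧ Equiangular.MaxEquiangularAsymp α ((k : ℝ) / ((k : ℝ) - 1))) ∧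
      (Equiangular.spectralRadiusOrder ((1 - α) / (2 * α)) = ⊤ →
        Equiangular.MaxEquiangularAsymp α 1)) ∧
    Equiangular.MaxEquiangularAsymp (1 / 3) 2 ∧
    Equiangular.MaxEquiangularAsymp (1 / 5) (3 / 2) ∧
    Equiangular.MaxEquiangularAsymp (1 / (1 + 2 * √2)) (3 / 2) := by
  have h5 : 2 < √5 := by
    rw [Real.lt_sqrt (by norm_num)]; norm_num
  have hstar : 2 ≤ √(2 + √5) := by
    exact Real.le_sqrt_of_sq_le (by linarith)
  have hs1 : 1 < √2 := by
    rw [Real.lt_sqrt (by norm_num)]; norm_num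
  have hs2 : √2 < 2 := by
    rw [Real.sqrt_lt' (by norm_num)]; norm_num
  refine ⟨fun α hα hα1 hlam => ⟨Equiangular.isGreatest_maxEquiangular hα hα1 hlam,
    fun k hk => ⟨Equiangular.two_le_order hα hα1 hk, Equiangular.asymp_of_order_eq hα hα1 hlam hk⟩,
    Equiangular.asymp_of_order_eq_top hα hα1 hlam⟩, ?_, ?_, ?_⟩
  -- The three angles have `λ = 1`, `2`, `√2`, attained by an edge, a triangle and the path on three
  -- vertices.
  · have e : ((1 : ℝ) - 1 / 3) / (2 * (1 / 3)) = ((2 : ℕ) : ℝ) - 1 := by norm_num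
    have := Equiangular.asymp_of_order_eq (α := 1 / 3) (by norm_num) (by norm_num)
      (by rw [e]; norm_num; linarith) (k := 2)
      (by rw [e]; exact Equiangular.spectralRadiusOrder_eq
            (Equiangular.hasSpectralRadius_top (by norm_num)) (by norm_num))
    norm_num at this ⊢
    exact this
  · have e : ((1 : ℝ) - 1 / 5) / (2 * (1 / 5)) = ((3 : ℕ) : ℝ) - 1 := by norm_num
    have := Equiangular.asymp_of_order_eq (α := 1 / 5) (by norm_num) (by norm_num)
      (by rw [e]; norm_num; linarith) (k := 3)
      (by rw [e]; exact Equiangular.spectralRadiusOrder_eq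
            (Equiangular.hasSpectralRadius_top (by norm_num)) (by norm_num))
    norm_num at this ⊢
    exact this
  · have e : ((1 : ℝ) - 1 / (1 + 2 * √2)) / (2 * (1 / (1 + 2 * √2))) = √2 := by
      have : (1 : ℝ) + 2 * √2 ≠ 0 := by positivity
      field_simp
      ring
    have := Equiangular.asymp_of_order_eq (α := 1 / (1 + 2 * √2)) (by positivity)
      (by rw [div_lt_one (by positivity)]; linarith) (by rw [e]; linarith) (k := 3)
      (by rw [e]; exact Equiangular.spectralRadiusOrder_eq
            Equiangular.hasSpectralRadius_cherry (by norm_num; linarith))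
    convert this using 1
    norm_num
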